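/- **Heterogeneous knapsack.** A market consists of $n$ items (agents), each item $i$ having a public type $t_i\in\{1,\dots,m\}$ and a public value $v_i\ge 0$, and a public budget $B>0$; each agent $i$ has a private cost $c_i\ge 0$. A set $S$ of items is *type-feasible* if it contains at most one item of each type. Put $v(S)=\sum_{i\in S}v_i$ and $\mathrm{opt}(c)=\max\{v(S): S \text{ type-feasible},\ \sum_{i\in S}c_i\le B\}$. A *(deterministic) mechanism* assigns to every market and every vector of bids $b\in[0,\infty)^n$ a type-feasible set $S(b)$ of winners and payments $p(b)\in\mathbb R^n$, with $p_i(b)=0$ for $i\notin S(b)$ (no positive transfer) and $p_i(b)\ge b_i$ for $i\in S(b)$ (individual rationality). It is *truthful* if for every agent $i$, all bids of the others, and every true cost $c_i\ge0$, bidding $c_i$ maximizes over all bids in $[0,\infty)$ the utility of $i$, which is $p_i-c_i$ if $i$ wins and $0$ otherwise. It is *budget feasible* if $\sum_i p_i(b)\le B$ for all bids $b$. It is a *$\rho$-approximation* if $\mathrm{opt}(c)\le\rho\, v(S(c))$ for all markets and all cost vectors $c$. It is *polynomial* if one real-RAM program (arithmetic, square roots and comparisons of real numbers at unit cost, rational constants,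 no rounding; counters and addresses with addition, subtraction and comparison at unit cost) computes, for all markets and bids, both the winners and the payments in a number of steps bounded by a polynomial in $n+m$. A *randomized mechanism* is a probability distribution over finitely many deterministic mechanisms. It is universally truthful and budget feasible if each of these deterministic mechanisms is truthful and budget feasible; it is a $\rho$-approximation if $\mathrm{opt}(c)\le\rho\,\mathbb E[v(S(c))]$ for all markets and all cost vectors $c$; it is polynomial if the probabilities are rational (and independent of the market and the bids) and each of the deterministic mechanisms is polynomial. **Theorem.** For knapsack with heterogeneous items there exist 1. a deterministic polynomial truthful budget feasible mechanism that is a $(2+\sqrt2)$-approximation, and 2. a randomized polynomial universally truthful budget feasible mechanism that is a $3$-approximation. -/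

import Mathlib

/-! ### A real RAM

Memory consists of finitely many named arrays (the names are written in the program) of natural
numbers and of real numbers.  Natural numbers serve as counters and addresses and can only be added,
subtracted and compared; real numbers can be added, subtracted, multiplied, divided, rooted and
compared.  There is no rounding from reals to natural numbers, and only rational constants are
available.  Every operation, memory access, comparison and assignment costs one step. -/

namespace RealRAM

/-- `nat a k` and `real a k` are the `k`-th cells of the arrays named `a`. -/
structure Mem where
  nat : ℕ → ℕ → ℕ
  real : ℕ → ℕ → ℝ

/-- Write a natural number into cell `k` of the natural-number array `a`. -/
def Mem.setNat (σ : Mem) (a k x : ℕ) : Mem :=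
  { σ with nat := Function.update σ.nat a (Function.update (σ.nat a) k x) }

/-- Write a real number into cell `k` of the real array `a`. -/
noncomputable def Mem.setReal (σ : Mem) (a k : ℕ) (x : ℝ) : Mem :=
  { σ with real := Function.update σ.real a (Function.update (σ.real a) k x) }

/-- Natural-number expressions; `get a k` reads the cell of array `a` at the computed address `k`,
and `sub` is truncated subtraction. -/
inductive NExp where
  | const (k : ℕ)
  | get (a : ℕ) (k : NExp)
  | add (e f : NExp)
  | sub (e f : NExp)

namespace NExp

def eval (σ : Mem) : NExp → ℕ
  | const k => k
  | get a k => σ.nat a (k.eval σ)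
  | add e f => e.eval σ + f.eval σ
  | sub e f => e.eval σ - f.eval σ

def cost : NExp → ℕ
  | const _ => 1
  | get _ k => k.cost + 1
  | add e f => e.cost + f.cost + 1
  | sub e f => e.cost + f.cost + 1

end NExp

/-- Real expressions; dividing by zero and rooting a negative number return zero. -/
inductive RExp where
  | const (q : ℚ)
  | get (a : ℕ) (k : NExp)
  | add (e f : RExp)
  | sub (e f : RExp)
  | mul (e f : RExp)
  | div (e f : RExp)
  | sqrt (e : RExp)

namespace RExp

noncomputable def eval (σ : Mem) : RExp → ℝ
  | const q => (q : ℝ)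
  | get a k => σ.real a (k.eval σ)
  | add e f => e.eval σ + f.eval σ
  | sub e f => e.eval σ - f.eval σ
  | mul e f => e.eval σ * f.eval σ
  | div e f => e.eval σ / f.eval σ
  | sqrt e => Real.sqrt (e.eval σ)

def cost : RExp → ℕ
  | const _ => 1
  | get _ k => k.cost + 1
  | add e f => e.cost + f.cost + 1
  | sub e f => e.cost + f.cost + 1
  | mul e f => e.cost + f.cost + 1
  | div e f => e.cost + f.cost + 1
  | sqrt e => e.cost + 1

end RExp

/-- Tests. -/
inductive Test where
  | natLe (e f : NExp)
  | realLe (e f : RExp)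
  | not (p : Test)
  | and (p q : Test)

namespace Test

def Holds (σ : Mem) : Test → Prop
  | natLe e f => e.eval σ ≤ f.eval σ
  | realLe e f => e.eval σ ≤ f.eval σ
  | not p => ¬ p.Holds σ
  | and p q => p.Holds σ ∧ q.Holds σ

def cost : Test → ℕ
  | natLe e f => e.cost + f.cost + 1
  | realLe e f => e.cost + f.cost + 1
  | not p => p.cost + 1
  | and p q => p.cost + q.cost + 1

end Test

/-- Programs. -/
inductive Prog where
  | skip
  | setNat (a : ℕ) (k : NExp) (e : NExp)
  | setReal (a : ℕ) (k : NExp) (e : RExp)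
  | seq (P Q : Prog)
  | cond (p : Test) (P Q : Prog)
  | loop (p : Test) (P : Prog)

/-- `Runs P σ s τ`: started in memory `σ`, the program `P` halts after exactly `s` steps with
memory `τ`.  (`loop p P` is "while `p` do `P`".) -/
inductive Runs : Prog → Mem → ℕ → Mem → Prop
  | skip (σ : Mem) : Runs Prog.skip σ 1 σ
  | setNat (σ : Mem) (a : ℕ) (k e : NExp) :
      Runs (Prog.setNat a k e) σ (k.cost + e.cost + 1) (σ.setNat a (k.eval σ) (e.eval σ))
  | setReal (σ : Mem) (a : ℕ) (k : NExp) (e : RExp) :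
      Runs (Prog.setReal a k e) σ (k.cost + e.cost + 1) (σ.setReal a (k.eval σ) (e.eval σ))
  | seq {P Q : Prog} {σ τ υ : Mem} {s t : ℕ} :
      Runs P σ s τ → Runs Q τ t υ → Runs (Prog.seq P Q) σ (s + t) υ
  | cond_true {p : Test} {P Q : Prog} {σ τ : Mem} {s : ℕ} :
      p.Holds σ → Runs P σ s τ → Runs (Prog.cond p P Q) σ (p.cost + s + 1) τ
  | cond_false {p : Test} {P Q : Prog} {σ τ : Mem} {s : ℕ} :
      ¬ p.Holds σ → Runs Q σ s τ → Runs (Prog.cond p P Q) σ (p.cost + s + 1) τ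
  | loop_true {p : Test} {P : Prog} {σ τ υ : Mem} {s t : ℕ} :
      p.Holds σ → Runs P σ s τ → Runs (Prog.loop p P) τ t υ →
      Runs (Prog.loop p P) σ (p.cost + s + t + 1) υ
  | loop_false {p : Test} {P : Prog} {σ : Mem} :
      ¬ p.Holds σ → Runs (Prog.loop p P) σ (p.cost + 1) σ

end RealRAM

/-! ### Knapsack with heterogeneous items and budget feasible mechanisms -/

namespace HetKnapsack

/-- The public data: `n` items of `m` types, their types and values, and the budget. -/
structure Market where
  n : ℕ
  m : ℕ
  type : Fin n → Fin m
  value : Fin n → ℝ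
  budget : ℝ
  value_nonneg : ∀ i, 0 ≤ value i
  budget_pos : 0 < budget

namespace Market

/-- The total value of a set of items. -/
def val (I : Market) (S : Finset (Fin I.n)) : ℝ := ∑ i ∈ S, I.value i

/-- At most one item of each type. -/
def DistinctTypes (I : Market) (S : Finset (Fin I.n)) : Prop :=
  ∀ i ∈ S, ∀ j ∈ S, I.type i = I.type j → i = j

/-- The solutions of the knapsack problem for the cost vector `c`. -/
def Feasible (I : Market) (c : Fin I.n → ℝ) (S : Finset (Fin I.n)) : Prop :=
  I.DistinctTypes S ∧ ∑ i ∈ S, c i ≤ I.budget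

open Classical in
/-- The optimal value of the knapsack problem for the cost vector `c`. -/
noncomputable def opt (I : Market) (c : Fin I.n → ℝ) : ℝ :=
  (Finset.univ.filter (I.Feasible c)).sup'
    ⟨∅, by simp [Feasible, DistinctTypes, I.budget_pos.le]⟩ I.val

end Market

/-- A deterministic mechanism: for every market and bid vector, a set of winners and payments. -/
structure Mechanism where
  winners : (I : Market) → (Fin I.n → ℝ) → Finset (Fin I.n)
  pay : (I : Market) → (Fin I.n → ℝ) → Fin I.n → ℝ

namespace Mechanism

/-- The utility of agent `i` with true cost `x` when the bids are `b`. -/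
noncomputable def utility (M : Mechanism) (I : Market) (i : Fin I.n) (x : ℝ)
    (b : Fin I.n → ℝ) : ℝ :=
  if i ∈ M.winners I b then M.pay I b i - x else 0

/-- The winners always have different types. -/
def PicksDistinctTypes (M : Mechanism) : Prop :=
  ∀ (I : Market) (b : Fin I.n → ℝ), (∀ i, 0 ≤ b i) → I.DistinctTypes (M.winners I b)

def NoPositiveTransfer (M : Mechanism) : Prop :=
  ∀ (I : Market) (b : Fin I.n → ℝ), (∀ i, 0 ≤ b i) → ∀ i, i ∉ M.winners I b → M.pay I b i = 0

def IndividuallyRational (M : Mechanism) : Prop :=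
  ∀ (I : Market) (b : Fin I.n → ℝ), (∀ i, 0 ≤ b i) → ∀ i, i ∈ M.winners I b → b i ≤ M.pay I b i

/-- Bidding the true cost `b i` is a best response of agent `i` to any bids of the others. -/
def Truthful (M : Mechanism) : Prop :=
  ∀ (I : Market) (b : Fin I.n → ℝ), (∀ i, 0 ≤ b i) → ∀ (i : Fin I.n) (x : ℝ), 0 ≤ x →
    M.utility I i (b i) (Function.update b i x) ≤ M.utility I i (b i) b

def BudgetFeasible (M : Mechanism) : Prop :=
  ∀ (I : Market) (b : Fin I.n → ℝ), (∀ i, 0 ≤ b i) → ∑ i, M.pay I b i ≤ I.budget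

/-- The approximation ratio is at most `ρ`. -/
def Approximates (M : Mechanism) (ρ : ℝ) : Prop :=
  ∀ (I : Market) (c : Fin I.n → ℝ), (∀ i, 0 ≤ c i) → I.opt c ≤ ρ * I.val (M.winners I c)

/-- A truthful budget feasible mechanism for heterogeneous knapsack. -/
structure IsTruthfulBudgetFeasible (M : Mechanism) : Prop where
  distinctTypes : M.PicksDistinctTypes
  noPositiveTransfer : M.NoPositiveTransfer
  individuallyRational : M.IndividuallyRational
  truthful : M.Truthful
  budgetFeasible : M.BudgetFeasible

end Mechanism

/-- The initial memory: `n` and `m` in the natural-number array `0`, the types in the natural-number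
array `1`, the budget in the real array `0`, the values in the real array `1` and the bids in the
real array `2`; all other cells are zero. -/
noncomputable def inputMem (I : Market) (b : Fin I.n → ℝ) : RealRAM.Mem where
  nat a k :=
    if a = 0 then (if k = 0 then I.n else if k = 1 then I.m else 0)
    else if a = 1 then (if h : k < I.n then (I.type ⟨k, h⟩ : ℕ) else 0)
    else 0
  real a k :=
    if a = 0 then (if k = 0 then I.budget else 0)
    else if a = 1 then (if h : k < I.n then I.value ⟨k, h⟩ else 0)
    else if a = 2 then (if h : k < I.n then b ⟨k, h⟩ else 0)
    else 0

open Classical in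
/-- One program computes the winners (as 0/1 flags in the natural-number array `2`) and the payments
(in the real array `3`) for all markets and bids, within a number of steps that is polynomial in the
number of items and types. -/
def Mechanism.PolyTime (M : Mechanism) : Prop :=
  ∃ (P : RealRAM.Prog) (p : Polynomial ℕ),
    ∀ (I : Market) (b : Fin I.n → ℝ), (∀ i, 0 ≤ b i) →
      ∃ (s : ℕ) (τ : RealRAM.Mem), RealRAM.Runs P (inputMem I b) s τ ∧ s ≤ p.eval (I.n + I.m) ∧
        ∀ i : Fin I.n, τ.nat 2 i = (if i ∈ M.winners I b then 1 else 0) ∧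
          τ.real 3 i = M.pay I b i

/-- A randomized mechanism: a distribution over finitely many deterministic mechanisms. -/
structure RandomizedMechanism where
  Ω : Type
  [fintype : Fintype Ω]
  law : PMF Ω
  mech : Ω → Mechanism

namespace RandomizedMechanism

attribute [instance] RandomizedMechanism.fintype

/-- Every deterministic mechanism of the family is truthful and budget feasible. -/
def IsUniversallyTruthfulBudgetFeasible (R : RandomizedMechanism) : Prop :=
  ∀ ω, (R.mech ω).IsTruthfulBudgetFeasible

/-- The expected total value of the winners. -/
noncomputable def expectedVal (R : RandomizedMechanism) (I : Market) (b : Fin I.n → ℝ) : ℝ :=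
  ∑ ω, (R.law ω).toReal * I.val ((R.mech ω).winners I b)

/-- The approximation ratio, in expectation, is at most `ρ`. -/
def Approximates (R : RandomizedMechanism) (ρ : ℝ) : Prop :=
  ∀ (I : Market) (c : Fin I.n → ℝ), (∀ i, 0 ≤ c i) → I.opt c ≤ ρ * R.expectedVal I c

/-- The distribution, which does not depend on the market or the bids, has rational probabilities,
so that it can be sampled by one roll of a fair die, and each deterministic mechanism of the family
runs in polynomial time. -/
def PolyTime (R : RandomizedMechanism) : Prop :=
  (∀ ω, ∃ q : ℚ, (R.law ω).toReal = (q : ℝ)) ∧ ∀ ω, (R.mech ω).PolyTime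

end RandomizedMechanism

end HetKnapsack

/-! ### Vocabulary: tops, hulls, acceptance, price and test -/

namespace HetKnapsack

/-! Order the active items by rate (cost per unit of value). The accepted items form a prefix of
this order. Let `V` be the largest value of a type-feasible set of accepted items and `s` the
largest value of an active item. The greedy rule buys the best accepted item of each type at one
price per unit of value, the minimum of `B / V` and the rate of the first rejected item. Payments
total at most `B`, and a winner who bids anything below its payment changes neither the accepted set
nor the price (`setCost_accepted`, `setCost_price`).

If `k` is the first rejected item, of rate `r`, then `B < r * (V + v k)`. In any solution the
accepted items are worth at most `V`, and all others of positive value have rate at least `r`, so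
they are worth at most `B / r`. Hence `opt ≤ 2 * V + s` (`Solution.value_le`). Buying the most
valuable item with probability 1/3 and running greedy with probability 2/3 has expected value `(s +
2 * V) / 3`, which gives ratio 3.

The deterministic rule must choose between `s` and `V` without giving an agent a useful lever. It
tests whether the items of rate at most `t = B / ((1 + √2/2) * s)`, without the most valuable item,
are worth more than `√2/2 * s`. If they are, then `V ≥ √2/2 * s`, so `opt ≤ (2 + √2) * V`. If not,
the cheap items, the most valuable item and the items of rate above `t` contribute at most `√2/2 + 1
+ (1 + √2/2) = 2 + √2` times `s`. The test ignores the bid of the most valuable item as long as that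
item stays active. An item whose presence decides the test is paid at most `t` per unit of value, so
that every bid below its payment keeps it cheap.

For polynomial time, each quantity above is built from sums and comparisons over items nested to
constant depth. `Computes` and `Decides` are closed under these operations, with time bounds that do
not depend on the storage level. -/

/-- The public data and the bids, indexed by natural numbers. -/
structure Data where
  n : ℕ
  ty : ℕ → ℕ
  B : ℝ
  v : ℕ → ℝ
  c : ℕ → ℝ

namespace Data

section

open scoped Classical

/-- Values and costs are nonnegative and the budget is positive. -/
structure Valid (D : Data) : Prop where
  v_nonneg : ∀ i, 0 ≤ D.v i
  c_nonneg : ∀ i, 0 ≤ D.c i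
  B_pos : 0 < D.B

/-- Replace the bid of item `i` by `x`. -/
noncomputable def setCost (D : Data) (i : ℕ) (x : ℝ) : Data :=
  { D with c := Function.update D.c i x }

/-- `i` is the most valuable item of its type in `Q`; ties go to the smaller index. -/
def Top (D : Data) (Q : ℕ → Prop) (i : ℕ) : Prop :=
  Q i ∧ ∀ k < D.n, Q k → D.ty k = D.ty i → D.v k < D.v i ∨ (D.v k = D.v i ∧ i ≤ k)

/-- The largest value of a subset of `Q` with distinct types. -/
noncomputable def hull (D : Data) (Q : ℕ → Prop) : ℝ :=
  ∑ j ∈ Finset.range D.n, if D.Top Q j then D.v j else 0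

/-- Items of positive value that are affordable on their own. -/
def Active (D : Data) (i : ℕ) : Prop := i < D.n ∧ 0 < D.v i ∧ D.c i ≤ D.B

/-- The cost per unit of value. -/
noncomputable def rate (D : Data) (i : ℕ) : ℝ := D.c i / D.v i

/-- The order in which the greedy rule considers the items. -/
def Before (D : Data) (i j : ℕ) : Prop :=
  D.rate i < D.rate j ∨ (D.rate i = D.rate j ∧ i ≤ j)

/-- Item `i` is accepted if the budget suffices to pay its rate for all the value available from the
items up to `i`. -/
def Accepted (D : Data) (i : ℕ) : Prop :=
  D.Active i ∧ D.rate i * D.hull (fun k => D.Active k ∧ D.Before k i) ≤ D.B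

def Rejected (D : Data) (i : ℕ) : Prop := D.Active i ∧ ¬ D.Accepted i

def FirstRejected (D : Data) (k : ℕ) : Prop :=
  D.Rejected k ∧ ∀ j < D.n, D.Rejected j → D.Before k j

/-- The total value of the winners of the greedy rule. -/
noncomputable def total (D : Data) : ℝ := D.hull D.Accepted

/-- The price which the greedy rule pays per unit of value. -/
noncomputable def price (D : Data) : ℝ :=
  if ∃ k < D.n, D.Rejected k then
    ∑ k ∈ Finset.range D.n,
      if D.FirstRejected k then min (D.rate k) (D.B / D.total) else 0
  else D.B / D.total

/-- The most valuable active item; ties go to the smaller index. -/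
def Star (D : Data) (i : ℕ) : Prop :=
  D.Active i ∧ ∀ k < D.n, D.Active k → D.v k < D.v i ∨ (D.v k = D.v i ∧ i ≤ k)

/-- The largest value of an active item. -/
noncomputable def starValue (D : Data) : ℝ :=
  ∑ j ∈ Finset.range D.n, if D.Star j then D.v j else 0

/-- The rate at which the deterministic rule tests the market without its most valuable item. -/
noncomputable def testRate (D : Data) : ℝ := D.B / ((1 + √2 / 2) * D.starValue)

/-- Excluding the most valuable item makes the test insensitive to the bid of the agent who wins
when the test fails. -/
def Cheap (D : Data) (j : ℕ) : Prop := D.Active j ∧ ¬ D.Star j ∧ D.rate j ≤ D.testRate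

/-- The cheap items are worth enough to prefer the greedy rule to the most valuable item. -/
def PreferGreedy (D : Data) : Prop := √2 / 2 * D.starValue < D.hull D.Cheap

/-- The greedy rule would not be preferred without item `i`. -/
def Pivotal (D : Data) (i : ℕ) : Prop :=
  ¬ √2 / 2 * D.starValue < D.hull (fun j => D.Cheap j ∧ ¬ j = i)

end

/-! ### The value of a set of items -/

variable {D : Data}

theorem exists_top (Q : ℕ → Prop) {i : ℕ} (hi : i < D.n) (hQ : Q i) :
    ∃ j < D.n, D.Top Q j ∧ D.ty j = D.ty i ∧ D.v i ≤ D.v j := by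
  classical
  let s := (Finset.range D.n).filter fun k => Q k ∧ D.ty k = D.ty i
  have hs : s.Nonempty := ⟨i, by simp [s, hi, hQ]⟩
  -- The order dual makes the smaller index win ties, in agreement with `Top`.
  obtain ⟨j, hj, hmax⟩ := s.exists_max_image (fun k => toLex (D.v k, OrderDual.toDual k)) hs
  have hj' : j < D.n ∧ Q j ∧ D.ty j = D.ty i := by simpa [s] using hj
  have key : ∀ k < D.n, Q k → D.ty k = D.ty i →
      D.v k < D.v j ∨ (D.v k = D.v j ∧ j ≤ k) := by
    intro k hk hQk hty
    have := hmax k (by simp [s, hk, hQk, hty])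
    simpa [Prod.Lex.toLex_le_toLex] using this
  refine ⟨j, hj'.1, ⟨hj'.2.1, fun k hk hQk hty => key k hk hQk (hty.trans hj'.2.2)⟩, hj'.2.2, ?_⟩
  rcases key i hi hQ rfl with h | h
  · exact h.le
  · exact h.1.le

theorem Top.eq {Q : ℕ → Prop} {i j : ℕ} (hi : i < D.n) (hj : j < D.n) (h : D.Top Q i)
    (h' : D.Top Q j) (hty : D.ty i = D.ty j) : i = j := by
  rcases h.2 j hj h'.1 hty.symm with h1 | h1 <;> rcases h'.2 i hi h.1 hty with h2 | h2
  · linarith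
  · linarith [h2.1]
  · linarith [h1.1]
  · omega

theorem hull_eq_sum_filter (Q : ℕ → Prop) [DecidablePred (D.Top Q)] :
    D.hull Q = ∑ j ∈ (Finset.range D.n).filter (D.Top Q), D.v j := by
  rw [hull, Finset.sum_filter]
  exact Finset.sum_congr rfl fun j _ => by congr

/-- Sending each item to the top item of its type is injective on a set with distinct types and
never loses value. This is the extremal property through which `hull` is used. -/
theorem sum_le_hull (hD : D.Valid) {Q : ℕ → Prop} {T : Finset ℕ} (hT : ∀ i ∈ T, i < D.n ∧ Q i)
    (hty : ∀ i ∈ T, ∀ j ∈ T, D.ty i = D.ty j → i = j) : ∑ i ∈ T, D.v i ≤ D.hull Q := by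
  classical
  have h : ∀ i, ∃ j, i ∈ T → j < D.n ∧ D.Top Q j ∧ D.ty j = D.ty i ∧ D.v i ≤ D.v j := by
    intro i
    by_cases hi : i ∈ T
    · obtain ⟨j, h1, h2⟩ := exists_top Q (hT i hi).1 (hT i hi).2
      exact ⟨j, fun _ => ⟨h1, h2⟩⟩
    · exact ⟨0, fun h => absurd h hi⟩
  choose f hf using h
  have hinj : Set.InjOn f T := by
    intro i hi j hj hij
    refine hty i hi j hj ?_
    rw [← (hf i hi).2.2.1, ← (hf j hj).2.2.1, hij]
  calc ∑ i ∈ T, D.v i ≤ ∑ i ∈ T, D.v (f i) := Finset.sum_le_sum fun i hi => (hf i hi).2.2.2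
    _ = ∑ j ∈ T.image f, D.v j := (Finset.sum_image hinj).symm
    _ ≤ ∑ j ∈ (Finset.range D.n).filter (D.Top Q), D.v j := by
        refine Finset.sum_le_sum_of_subset_of_nonneg ?_ fun j _ _ => hD.v_nonneg j
        intro j hj
        obtain ⟨i, hi, rfl⟩ := Finset.mem_image.1 hj
        simp [(hf i hi).1, (hf i hi).2.1]
    _ = D.hull Q := (hull_eq_sum_filter Q).symm

/-- Delete `k` from the set of tops of `Q`; what remains is a type-feasible subset of `Q'`. -/
theorem hull_le_add (hD : D.Valid) {Q Q' : ℕ → Prop} (k : ℕ)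
    (h : ∀ i < D.n, Q i → Q' i ∨ i = k) : D.hull Q ≤ D.hull Q' + D.v k := by
  classical
  set T := (Finset.range D.n).filter (D.Top Q)
  have h1 : ∑ i ∈ T.erase k, D.v i ≤ D.hull Q' := by
    refine sum_le_hull hD ?_ ?_
    · intro i hi
      simp only [T, Finset.mem_erase, Finset.mem_filter, Finset.mem_range] at hi
      exact ⟨hi.2.1, (h i hi.2.1 hi.2.2.1).resolve_right hi.1⟩
    · intro i hi j hj
      simp only [T, Finset.mem_erase, Finset.mem_filter, Finset.mem_range] at hi hj
      exact hi.2.2.eq hi.2.1 hj.2.1 hj.2.2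
  rw [hull_eq_sum_filter]
  by_cases hk : k ∈ T
  · rw [← Finset.sum_erase_add _ _ hk]
    linarith
  · rw [Finset.erase_eq_of_notMem hk] at h1
    linarith [hD.v_nonneg k]

theorem hull_mono (hD : D.Valid) {Q Q' : ℕ → Prop}
    (h : ∀ i < D.n, Q i → Q' i) : D.hull Q ≤ D.hull Q' := by
  classical
  rw [hull_eq_sum_filter]
  refine sum_le_hull hD ?_ ?_
  · intro i hi
    simp only [Finset.mem_filter, Finset.mem_range] at hi
    exact ⟨hi.1, h i hi.1 hi.2.1⟩
  · intro i hi j hj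
    simp only [Finset.mem_filter, Finset.mem_range] at hi hj
    exact hi.2.eq hi.1 hj.1 hj.2

theorem value_le_hull (hD : D.Valid) {Q : ℕ → Prop} {i : ℕ} (hi : i < D.n) (hQ : Q i) :
    D.v i ≤ D.hull Q := by
  simpa using sum_le_hull (T := {i}) hD (by simpa using ⟨hi, hQ⟩) (by simp)

theorem hull_nonneg (hD : D.Valid) (Q : ℕ → Prop) : 0 ≤ D.hull Q := by
  unfold hull
  exact Finset.sum_nonneg fun j _ => by split_ifs <;> simp [hD.v_nonneg]

theorem hull_congr {Q Q' : ℕ → Prop} (h : ∀ i, Q i ↔ Q' i) : D.hull Q = D.hull Q' := by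
  rw [show Q = Q' from funext fun i => propext (h i)]

/-! ### The greedy rule -/

theorem rate_nonneg (hD : D.Valid) (i : ℕ) : 0 ≤ D.rate i :=
  div_nonneg (hD.c_nonneg i) (hD.v_nonneg i)

theorem Before.rate_le {i j : ℕ} (h : D.Before i j) : D.rate i ≤ D.rate j := by
  rcases h with h | h
  exacts [h.le, h.1.le]

theorem Before.trans {i j k : ℕ} (h : D.Before i j) (h' : D.Before j k) : D.Before i k := by
  rcases h with h | h <;> rcases h' with h' | h'
  · exact .inl (h.trans h')
  · exact .inl (h'.1 ▸ h)
  · exact .inl (h.1 ▸ h')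
  · exact .inr ⟨h.1.trans h'.1, h.2.trans h'.2⟩

theorem before_total (i j : ℕ) : D.Before i j ∨ D.Before j i := by
  rcases lt_trichotomy (D.rate i) (D.rate j) with h | h | h
  · exact .inl (.inl h)
  · rcases le_total i j with h' | h'
    · exact .inl (.inr ⟨h, h'⟩)
    · exact .inr (.inr ⟨h.symm, h'⟩)
  · exact .inr (.inl h)

theorem Before.antisymm {i j : ℕ} (h : D.Before i j) (h' : D.Before j i) : i = j := by
  rcases h with h | h <;> rcases h' with h' | h'
  · linarith
  · linarith [h'.1]
  · linarith [h.1]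
  · omega

/-- Along the order both the rate and the hull of the prefix grow, so the acceptance inequality
passes to earlier items and acceptance is a prefix property. -/
theorem Accepted.of_before (hD : D.Valid) {i j : ℕ} (hj : D.Accepted j) (hi : D.Active i)
    (h : D.Before i j) : D.Accepted i := by
  refine ⟨hi, le_trans ?_ hj.2⟩
  refine mul_le_mul h.rate_le ?_ (hull_nonneg hD _) (rate_nonneg hD j)
  exact hull_mono hD fun k _ hk => ⟨hk.1, hk.2.trans h⟩

theorem Accepted.before_of_rejected (hD : D.Valid) {i k : ℕ} (hi : D.Accepted i)
    (hk : D.Rejected k) : D.Before i k :=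
  (before_total i k).resolve_right fun h => hk.2 (hi.of_before hD hk.1 h)

theorem exists_first (Q : ℕ → Prop) (h : ∃ k < D.n, Q k) :
    ∃ k < D.n, Q k ∧ ∀ j < D.n, Q j → D.Before k j := by
  classical
  obtain ⟨k, hk, hQ⟩ := h
  obtain ⟨j, hj, hmin⟩ := ((Finset.range D.n).filter Q).exists_min_image
    (fun i => toLex (D.rate i, i)) ⟨k, by simp [hk, hQ]⟩
  simp only [Finset.mem_filter, Finset.mem_range, Prod.Lex.toLex_le_toLex] at hj hmin
  exact ⟨j, hj.1, hj.2, fun i hi hQi => hmin i ⟨hi, hQi⟩⟩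

theorem exists_last (Q : ℕ → Prop) (h : ∃ k < D.n, Q k) :
    ∃ k < D.n, Q k ∧ ∀ j < D.n, Q j → D.Before j k := by
  classical
  obtain ⟨k, hk, hQ⟩ := h
  obtain ⟨j, hj, hmin⟩ := ((Finset.range D.n).filter Q).exists_max_image
    (fun i => toLex (D.rate i, i)) ⟨k, by simp [hk, hQ]⟩
  simp only [Finset.mem_filter, Finset.mem_range, Prod.Lex.toLex_le_toLex] at hj hmin
  exact ⟨j, hj.1, hj.2, fun i hi hQi => hmin i ⟨hi, hQi⟩⟩

theorem price_of_forall (h : ∀ k < D.n, ¬ D.Rejected k) : D.price = D.B / D.total := by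
  rw [price, if_neg]
  rintro ⟨k, hk, hr⟩
  exact h k hk hr

theorem FirstRejected.price_eq {k : ℕ} (hk : D.FirstRejected k) :
    D.price = min (D.rate k) (D.B / D.total) := by
  have hkn : k < D.n := hk.1.1.1
  rw [price, if_pos ⟨k, hkn, hk.1⟩, Finset.sum_eq_single k]
  · rw [if_pos hk]
  · intro j hj hjk
    refine if_neg fun h => hjk ?_
    exact (h.2 k hkn hk.1).antisymm (hk.2 j h.1.1.1 h.1)
  · intro h
    exact absurd (Finset.mem_range.2 hkn) h

theorem firstRejected_cases (D : Data) :
    (∀ k < D.n, ¬ D.Rejected k) ∨ ∃ k, D.FirstRejected k := by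
  by_cases h : ∃ k < D.n, D.Rejected k
  · obtain ⟨k, _, h1, h2⟩ := exists_first D.Rejected h
    exact .inr ⟨k, h1, h2⟩
  · exact .inl fun k hk hr => h ⟨k, hk, hr⟩

theorem price_le_div (D : Data) : D.price ≤ D.B / D.total := by
  rcases D.firstRejected_cases with h | ⟨k, hk⟩
  · exact (price_of_forall h).le
  · exact hk.price_eq.trans_le (min_le_right _ _)

theorem price_le_rate {k : ℕ} (hk : D.Rejected k) : D.price ≤ D.rate k := by
  rcases D.firstRejected_cases with h | ⟨j, hj⟩
  · exact absurd hk (h k hk.1.1)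
  · exact hj.price_eq.trans_le ((min_le_left _ _).trans (hj.2 k hk.1.1 hk).rate_le)

theorem price_nonneg (hD : D.Valid) : 0 ≤ D.price := by
  have h0 : 0 ≤ D.B / D.total := div_nonneg hD.B_pos.le (hull_nonneg hD _)
  rcases D.firstRejected_cases with h | ⟨j, hj⟩
  · rwa [price_of_forall h]
  · rw [hj.price_eq]
    exact le_min (rate_nonneg hD j) h0

theorem price_mul_total_le (hD : D.Valid) : D.price * D.total ≤ D.B := by
  -- If the total is zero, `B / total` is the default value 0 and carries no information, but the
  -- product vanishes anyway.
  rcases (hull_nonneg hD D.Accepted).eq_or_lt with h | h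
  · rw [total, ← h, mul_zero]
    exact hD.B_pos.le
  · exact (le_div_iff₀ h).1 D.price_le_div

theorem Accepted.rate_le_price (hD : D.Valid) {i : ℕ} (hi : D.Accepted i) :
    D.rate i ≤ D.price := by
  have hV : 0 < D.total := hi.1.2.1.trans_le (value_le_hull hD hi.1.1 hi)
  have h0 : D.rate i ≤ D.B / D.total := by
    -- The prefix of the last accepted item contains all accepted items, so its acceptance
    -- inequality bounds its rate by `B / total`.
    obtain ⟨l, _, hl, hlast⟩ := exists_last D.Accepted ⟨i, hi.1.1, hi⟩
    rw [le_div_iff₀ hV]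
    refine le_trans ?_ hl.2
    refine mul_le_mul (hlast i hi.1.1 hi).rate_le ?_ hV.le (rate_nonneg hD l)
    exact hull_mono hD fun k hk hak => ⟨hak.1, hlast k hk hak⟩
  rcases D.firstRejected_cases with h | ⟨j, hj⟩
  · rwa [price_of_forall h]
  · rw [hj.price_eq]
    exact le_min (hi.before_of_rejected hD hj.1).rate_le h0

/-- Ensures that a bid below the greedy payment is at most `B`, so that the bidder stays active. -/
theorem value_mul_price_le (hD : D.Valid) {i : ℕ} (hi : D.Accepted i) :
    D.v i * D.price ≤ D.B := by
  refine le_trans ?_ (price_mul_total_le hD)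
  rw [mul_comm]
  exact mul_le_mul_of_nonneg_left (value_le_hull hD hi.1.1 hi) (price_nonneg hD)

theorem Accepted.cost_le (hD : D.Valid) {i : ℕ} (hi : D.Accepted i) :
    D.c i ≤ D.v i * D.price := by
  have := hi.rate_le_price hD
  rwa [rate, div_le_iff₀ hi.1.2.1, mul_comm] at this

/-! ### Changing one bid -/

section setCost

variable {i : ℕ} {x : ℝ}

theorem Valid.setCost (hD : D.Valid) (hx : 0 ≤ x) : (D.setCost i x).Valid where
  v_nonneg := hD.v_nonneg
  c_nonneg j := by
    by_cases h : j = i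
    · subst h
      simpa [Data.setCost] using hx
    · simpa [Data.setCost, h] using hD.c_nonneg j
  B_pos := hD.B_pos

theorem setCost_rate_self : (D.setCost i x).rate i = x / D.v i := by
  simp [rate, setCost]

theorem setCost_rate_of_ne {j : ℕ} (h : j ≠ i) : (D.setCost i x).rate j = D.rate j := by
  simp [rate, setCost, h]

theorem setCost_hull (Q : ℕ → Prop) : (D.setCost i x).hull Q = D.hull Q := rfl

theorem setCost_active (hi : D.Active i) (hx : x ≤ D.B) (j : ℕ) :
    (D.setCost i x).Active j ↔ D.Active j := by
  by_cases h : j = i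
  · subst h
    simp only [Active, setCost, Function.update_self]
    exact ⟨fun _ => hi, fun h => ⟨h.1, h.2.1, hx⟩⟩
  · simp [Active, setCost, h]

/-- Bids enter `Star` only through activity. -/
theorem setCost_star (hi : D.Active i) (hx : x ≤ D.B) (j : ℕ) :
    (D.setCost i x).Star j ↔ D.Star j := by
  simp only [Star, setCost_active hi hx]
  rfl

/-- The price separates accepted from rejected rates, and the new rate of `i` lies strictly below
it. Rejected items therefore keep `i` in their prefix and stay rejected; the new prefix of an
accepted item still consists of accepted items. -/
theorem setCost_accepted (hD : D.Valid) (hi : D.Accepted i) (hx0 : 0 ≤ x)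
    (hx : x < D.v i * D.price) (k : ℕ) : (D.setCost i x).Accepted k ↔ D.Accepted k := by
  have hxB : x ≤ D.B := hx.le.trans (value_mul_price_le hD hi)
  have hact := setCost_active hi.1 hxB
  have hD' : (D.setCost i x).Valid := hD.setCost hx0
  have hri : (D.setCost i x).rate i < D.price := by
    rwa [setCost_rate_self, div_lt_iff₀ hi.1.2.1, mul_comm]
  constructor
  · intro hk'
    by_contra hk
    have hkr : D.Rejected k := ⟨(hact k).1 hk'.1, hk⟩
    have hki : k ≠ i := fun h => hk (h ▸ hi)
    refine hk ⟨hkr.1, le_trans ?_ hk'.2⟩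
    rw [setCost_rate_of_ne hki, setCost_hull]
    refine mul_le_mul_of_nonneg_left (hull_mono hD ?_) (rate_nonneg hD k)
    rintro j - ⟨hj, hjk⟩
    refine ⟨(hact j).2 hj, ?_⟩
    by_cases hji : j = i
    · subst hji
      left
      rw [setCost_rate_of_ne hki]
      exact hri.trans_le (price_le_rate hkr)
    · rwa [Before, setCost_rate_of_ne hki, setCost_rate_of_ne hji]
  · intro hk
    have hrk : (D.setCost i x).rate k ≤ D.price := by
      by_cases hki : k = i
      · exact hki ▸ hri.le
      · rw [setCost_rate_of_ne hki]
        exact hk.rate_le_price hD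
    -- Rate and prefix hull are bounded separately, by the price and the total.
    refine ⟨(hact k).2 hk.1, le_trans (b := D.price * D.total) ?_ (price_mul_total_le hD)⟩
    refine mul_le_mul hrk ?_ (hull_nonneg hD' _) (price_nonneg hD)
    rw [setCost_hull, total]
    refine hull_mono hD ?_
    rintro j - ⟨hj, hjk⟩
    rw [hact] at hj
    by_contra hja
    have hji : j ≠ i := fun h => hja (h ▸ hi)
    -- Only here has the prefix of `k` really moved: a rejected `j` before `i` would have rate at
    -- least the price, against the strict bound on the new rate.
    by_cases hki : k = i
    · subst hki
      have h1 := hjk.rate_le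
      rw [setCost_rate_of_ne hji] at h1
      linarith [price_le_rate ⟨hj, hja⟩]
    · rw [Before, setCost_rate_of_ne hki, setCost_rate_of_ne hji] at hjk
      exact hja (hk.of_before hD hj hjk)

theorem setCost_total (hD : D.Valid) (hi : D.Accepted i) (hx0 : 0 ≤ x)
    (hx : x < D.v i * D.price) : (D.setCost i x).total = D.total := by
  rw [total, setCost_hull]
  exact hull_congr (setCost_accepted hD hi hx0 hx)

/-- The price is a function of the accepted total and of the rate of the first rejected item, which
is not `i`. -/
theorem setCost_price (hD : D.Valid) (hi : D.Accepted i) (hx0 : 0 ≤ x)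
    (hx : x < D.v i * D.price) : (D.setCost i x).price = D.price := by
  have hxB : x ≤ D.B := hx.le.trans (value_mul_price_le hD hi)
  have hrej : ∀ k, (D.setCost i x).Rejected k ↔ D.Rejected k := fun k => by
    rw [Rejected, Rejected, setCost_active hi.1 hxB, setCost_accepted hD hi hx0 hx]
  have hne : ∀ {k}, D.Rejected k → k ≠ i := fun hk h => hk.2 (h ▸ hi)
  rcases D.firstRejected_cases with h | ⟨k, hk⟩
  · rw [price_of_forall h,
      price_of_forall (D := D.setCost i x) fun k hk hr => h k hk ((hrej k).1 hr),
      setCost_total hD hi hx0 hx]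
    rfl
  · have hk' : (D.setCost i x).FirstRejected k := by
      refine ⟨(hrej k).2 hk.1, fun j hj hjr => ?_⟩
      rw [hrej] at hjr
      rw [Before, setCost_rate_of_ne (hne hk.1), setCost_rate_of_ne (hne hjr)]
      exact hk.2 j hj hjr
    rw [hk.price_eq, hk'.price_eq, setCost_total hD hi hx0 hx, setCost_rate_of_ne (hne hk.1)]
    rfl

theorem setCost_top_accepted (hD : D.Valid) (hi : D.Accepted i) (hx0 : 0 ≤ x)
    (hx : x < D.v i * D.price) (k : ℕ) :
    (D.setCost i x).Top (D.setCost i x).Accepted k ↔ D.Top D.Accepted k := by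
  simp only [Top, setCost_accepted hD hi hx0 hx]
  rfl

theorem setCost_starValue (hi : D.Active i) (hx : x ≤ D.B) :
    (D.setCost i x).starValue = D.starValue := by
  have h : (D.setCost i x).Star = D.Star := funext fun j => propext (setCost_star hi hx j)
  rw [starValue, h]
  rfl

theorem setCost_testRate (hi : D.Active i) (hx : x ≤ D.B) :
    (D.setCost i x).testRate = D.testRate := by
  rw [testRate, setCost_starValue hi hx]
  rfl

theorem setCost_cheap_of_ne (hi : D.Active i) (hx : x ≤ D.B) {j : ℕ} (h : j ≠ i) :
    (D.setCost i x).Cheap j ↔ D.Cheap j := by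
  rw [Cheap, setCost_active hi hx, setCost_star hi hx, setCost_testRate hi hx,
    setCost_rate_of_ne h]
  rfl

/-- The hull in `Pivotal` leaves out `i`, the only item whose rate has changed. -/
theorem setCost_pivotal (hi : D.Active i) (hx : x ≤ D.B) :
    (D.setCost i x).Pivotal i ↔ D.Pivotal i := by
  rw [Pivotal, Pivotal, setCost_starValue hi hx, setCost_hull]
  rw [hull_congr (Q' := fun j => D.Cheap j ∧ ¬ j = i)]
  intro j
  by_cases h : j = i
  · simp [h]
  · rw [setCost_cheap_of_ne hi hx h]

theorem setCost_preferGreedy_of_star (hi : D.Star i) (hx : x ≤ D.B) :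
    (D.setCost i x).PreferGreedy ↔ D.PreferGreedy := by
  rw [PreferGreedy, PreferGreedy, setCost_starValue hi.1 hx, setCost_hull, hull_congr]
  intro j
  by_cases h : j = i
  · subst h
    simp [Cheap, setCost_star hi.1 hx, hi]
  · rw [setCost_cheap_of_ne hi.1 hx h]

/-- A pivotal item stays cheap when its new rate is at most the test rate; for a non-pivotal one the
other cheap items already pass the test. -/
theorem setCost_preferGreedy (hD : D.Valid) (hi : D.Active i) (hx : x ≤ D.B)
    (h : D.PreferGreedy)
    (hp : D.Pivotal i → x ≤ D.v i * D.testRate) :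
    (D.setCost i x).PreferGreedy := by
  rw [PreferGreedy, setCost_starValue hi hx, setCost_hull]
  by_cases hpiv : D.Pivotal i
  · refine h.trans_le (hull_mono hD fun j _ hj => ?_)
    by_cases hji : j = i
    · subst hji
      refine ⟨(setCost_active hi hx j).2 hj.1, fun hs => hj.2.1 ((setCost_star hi hx j).1 hs), ?_⟩
      rw [setCost_testRate hi hx, setCost_rate_self, div_le_iff₀ hi.2.1, mul_comm]
      exact hp hpiv
    · rwa [setCost_cheap_of_ne hi hx hji]
  · refine (not_not.1 hpiv).trans_le (hull_mono hD fun j _ hj => ?_)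
    rw [setCost_cheap_of_ne hi hx hj.2]
    exact hj.1

end setCost

/-! ### Approximation -/

theorem exists_star {i : ℕ} (hi : D.Active i) : ∃ j, D.Star j := by
  -- With all types identified, the top active item is the most valuable one.
  obtain ⟨j, _, h1, -⟩ := exists_top (D := { D with ty := fun _ => 0 }) D.Active hi.1 hi
  exact ⟨j, h1.1, fun k hk ha => h1.2 k hk ha rfl⟩

theorem Star.eq {i j : ℕ} (hi : D.Star i) (hj : D.Star j) : i = j := by
  rcases hi.2 j hj.1.1 hj.1 with h | h <;> rcases hj.2 i hi.1.1 hi.1 with h' | h'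
  · linarith
  · linarith [h'.1]
  · linarith [h.1]
  · omega

theorem Star.starValue_eq {i : ℕ} (hi : D.Star i) : D.starValue = D.v i := by
  rw [starValue, Finset.sum_eq_single i]
  · rw [if_pos hi]
  · exact fun j _ hj => if_neg fun h => hj (h.eq hi)
  · exact fun h => absurd (Finset.mem_range.2 hi.1.1) h

theorem starValue_nonneg (hD : D.Valid) : 0 ≤ D.starValue := by
  unfold starValue
  exact Finset.sum_nonneg fun j _ => by split_ifs <;> simp [hD.v_nonneg]

theorem Active.le_starValue {i : ℕ} (hi : D.Active i) : D.v i ≤ D.starValue := by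
  obtain ⟨j, hj⟩ := exists_star hi
  rw [hj.starValue_eq]
  rcases hj.2 i hi.1 hi with h | h
  exacts [h.le, h.1.le]

/-- A solution of the knapsack problem. -/
structure Solution (D : Data) (T : Finset ℕ) : Prop where
  lt : ∀ i ∈ T, i < D.n
  inj : ∀ i ∈ T, ∀ j ∈ T, D.ty i = D.ty j → i = j
  cost_le : ∑ i ∈ T, D.c i ≤ D.B

theorem Solution.active (hD : D.Valid) {T : Finset ℕ} (hT : D.Solution T) {i : ℕ} (hi : i ∈ T)
    (hv : 0 < D.v i) : D.Active i :=
  ⟨hT.lt i hi, hv, (Finset.single_le_sum (fun j _ => hD.c_nonneg j) hi).trans hT.cost_le⟩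

/-- Everything active before `k`, except `k` itself, is accepted, so the prefix hull in the failed
inequality is at most `total + v k`. -/
theorem FirstRejected.budget_lt (hD : D.Valid) {k : ℕ} (hk : D.FirstRejected k) :
    D.B < D.rate k * (D.total + D.v k) := by
  have h1 : D.B < D.rate k * D.hull (fun j => D.Active j ∧ D.Before j k) :=
    not_le.1 fun h => hk.1.2 ⟨hk.1.1, h⟩
  refine h1.trans_le (mul_le_mul_of_nonneg_left (hull_le_add hD k ?_) (rate_nonneg hD k))
  rintro j hj ⟨ha, hb⟩
  by_contra hcon
  push Not at hcon
  exact hcon.2 (hb.antisymm (hk.2 j hj ⟨ha, hcon.1⟩))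

/-- Splitting a solution into items in `Q` and items of rate at least `r`. -/
theorem Solution.value_mul_le (hD : D.Valid) {T : Finset ℕ} (hT : D.Solution T) {Q : ℕ → Prop}
    {r : ℝ} (hr : 0 ≤ r) (h : ∀ i ∈ T, D.Active i → Q i ∨ r ≤ D.rate i) :
    r * ∑ i ∈ T, D.v i ≤ r * D.hull Q + D.B := by
  classical
  rw [← Finset.sum_filter_add_sum_filter_not T Q, mul_add]
  refine add_le_add (mul_le_mul_of_nonneg_left (sum_le_hull hD ?_ ?_) hr) ?_
  · intro i hi
    rw [Finset.mem_filter] at hi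
    exact ⟨hT.lt i hi.1, hi.2⟩
  · intro i hi j hj
    exact hT.inj i (Finset.mem_filter.1 hi).1 j (Finset.mem_filter.1 hj).1
  · rw [Finset.mul_sum]
    calc ∑ i ∈ T.filter fun i => ¬ Q i, r * D.v i ≤ ∑ i ∈ T.filter fun i => ¬ Q i, D.c i := by
          refine Finset.sum_le_sum fun i hi => ?_
          rw [Finset.mem_filter] at hi
          -- Items of value zero are not active, so the rate hypothesis says nothing about them;
          -- they are harmless because costs are nonnegative.
          rcases (hD.v_nonneg i).eq_or_lt with h0 | h0
          · rw [← h0, mul_zero]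
            exact hD.c_nonneg i
          · have := (h i hi.1 (hT.active hD hi.1 h0)).resolve_left hi.2
            rwa [rate, le_div_iff₀ h0] at this
      _ ≤ ∑ i ∈ T, D.c i :=
          Finset.sum_le_sum_of_subset_of_nonneg (Finset.filter_subset _ _)
            fun i _ _ => hD.c_nonneg i
      _ ≤ D.B := hT.cost_le

theorem Solution.value_le_hull (hD : D.Valid) {T : Finset ℕ} (hT : D.Solution T) {Q : ℕ → Prop}
    (h : ∀ i ∈ T, D.Active i → Q i) : ∑ i ∈ T, D.v i ≤ D.hull Q := by
  classical
  have : ∑ i ∈ T, D.v i = ∑ i ∈ T.filter fun i => 0 < D.v i, D.v i := by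
    refine (Finset.sum_filter_of_ne fun i _ hi => ?_).symm
    exact (hD.v_nonneg i).lt_of_ne' hi
  rw [this]
  refine sum_le_hull hD ?_ ?_
  · intro i hi
    rw [Finset.mem_filter] at hi
    exact ⟨hT.lt i hi.1, h i hi.1 (hT.active hD hi.1 hi.2)⟩
  · intro i hi j hj
    exact hT.inj i (Finset.mem_filter.1 hi).1 j (Finset.mem_filter.1 hj).1

/-- Split the solution at the rate of the first rejected item: accepted items give at most `total`,
the rest at most `B / rate`, which is below `total + v k`. -/
theorem Solution.value_le (hD : D.Valid) {T : Finset ℕ} (hT : D.Solution T) :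
    ∑ i ∈ T, D.v i ≤ 2 * D.total + D.starValue := by
  have hV : 0 ≤ D.total := hull_nonneg hD _
  rcases D.firstRejected_cases with h | ⟨k, hk⟩
  · have := hT.value_le_hull hD (Q := D.Accepted) fun i hi ha => by
      by_contra hn
      exact h i ha.1 ⟨ha, hn⟩
    rw [← total] at this
    linarith [starValue_nonneg hD]
  · have h1 := hk.budget_lt hD
    have hr : 0 < D.rate k := by
      refine (rate_nonneg hD k).lt_of_ne fun h0 => ?_
      rw [← h0, zero_mul] at h1
      exact absurd hD.B_pos h1.not_gt
    have h2 := hT.value_mul_le hD (Q := D.Accepted) hr.le fun i hi ha => by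
      by_cases hacc : D.Accepted i
      · exact .inl hacc
      · exact .inr (hk.2 i ha.1 ⟨ha, hacc⟩).rate_le
    rw [← total] at h2
    have h3 : D.rate k * ∑ i ∈ T, D.v i ≤ D.rate k * (D.total + (D.total + D.v k)) := by
      rw [mul_add]
      linarith
    linarith [le_of_mul_le_mul_left h3 hr, hk.1.1.le_starValue]

/-- If all cheap items are accepted, the test itself is the bound. Otherwise the first rejected rate
is at most the test rate, and `budget_lt` becomes `(1 + √2/2) * starValue < total + starValue`. -/
theorem PreferGreedy.starValue_le (hD : D.Valid) (h : D.PreferGreedy) :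
    √2 / 2 * D.starValue ≤ D.total := by
  by_cases hc : ∀ j < D.n, D.Cheap j → D.Accepted j
  · exact h.le.trans (hull_mono hD hc)
  · push Not at hc
    obtain ⟨j, hj, hcj, hna⟩ := hc
    rcases D.firstRejected_cases with h' | ⟨k, hk⟩
    · exact absurd ⟨hcj.1, hna⟩ (h' j hj)
    have hs : 0 < D.starValue := hcj.1.2.1.trans_le hcj.1.le_starValue
    have hV : 0 ≤ D.total := hull_nonneg hD _
    have h1 : D.rate k ≤ D.testRate := (hk.2 j hj ⟨hcj.1, hna⟩).rate_le.trans hcj.2.2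
    have h2 : D.B < D.testRate * (D.total + D.starValue) :=
      (hk.budget_lt hD).trans_le (mul_le_mul h1 (by linarith [hk.1.1.le_starValue])
        (by linarith [hD.v_nonneg k]) ((rate_nonneg hD k).trans h1))
    have hpos : 0 < (1 + √2 / 2) * D.starValue := by positivity
    rw [testRate, div_mul_eq_mul_div, lt_div_iff₀ hpos] at h2
    have := lt_of_mul_lt_mul_left h2 hD.B_pos.le
    linarith

/-- Split the solution at the test rate `t`, for which `B = t * (1 + √2/2) * starValue`; the failed
test bounds the cheap part and the star is added separately. -/
theorem Solution.value_le_of_not_preferGreedy (hD : D.Valid) {T : Finset ℕ} (hT : D.Solution T)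
    (h : ¬ D.PreferGreedy) : ∑ i ∈ T, D.v i ≤ (2 + √2) * D.starValue := by
  by_cases hs : ∃ i, D.Star i
  · obtain ⟨i, hi⟩ := hs
    have hsv : 0 < D.starValue := hi.starValue_eq ▸ hi.1.2.1
    have hr : 0 < D.testRate := div_pos hD.B_pos (by positivity)
    have h1 := hT.value_mul_le hD (Q := fun j => D.Cheap j ∨ j = i) hr.le fun j _ ha => by
      by_cases hr : D.rate j ≤ D.testRate
      · by_cases hst : D.Star j
        · exact .inl (.inr (hst.eq hi))
        · exact .inl (.inl ⟨ha, hst, hr⟩)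
      · exact .inr (not_le.1 hr).le
    have h2 : D.hull (fun j => D.Cheap j ∨ j = i) ≤ D.hull D.Cheap + D.v i :=
      hull_le_add hD i fun j _ hj => hj
    have h3 : D.B = D.testRate * ((1 + √2 / 2) * D.starValue) := by
      rw [testRate, div_mul_cancel₀]
      positivity
    rw [PreferGreedy, not_lt] at h
    rw [h3, ← mul_add] at h1
    have h4 := le_of_mul_le_mul_left h1 hr
    rw [← hi.starValue_eq] at h2
    linarith
  · have h0 : ∀ j, ¬ D.Active j := fun j hj => hs (exists_star hj)
    have h1 := hT.value_le_hull hD (Q := fun _ => False) fun i _ ha => h0 i ha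
    have h2 : D.hull (fun _ => False) = 0 := by simp [hull, Top]
    rw [h2] at h1
    exact h1.trans (mul_nonneg (by positivity) (starValue_nonneg hD))

end Data

end HetKnapsack

namespace HetKnapsack

open RealRAM

/-! ### Functions computed in polynomial time

Programs read the input arrays, keep index variables in the natural-number array `3` and
intermediate results in the arrays `4`. -/

/-- The input data and the current values of the index variables. -/
structure Env where
  data : Data
  var : ℕ → ℕ

namespace Env

def setVar (e : Env) (y k : ℕ) : Env := { e with var := Function.update e.var y k }

@[simp] theorem setVar_data (e : Env) (y k : ℕ) : (e.setVar y k).data = e.data := rfl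

@[simp] theorem setVar_var_self (e : Env) (y k : ℕ) : (e.setVar y k).var y = k := by
  simp [setVar]

theorem setVar_var_of_ne (e : Env) {x y : ℕ} (k : ℕ) (h : x ≠ y) :
    (e.setVar y k).var x = e.var x := by
  simp [setVar, h]

@[simp] theorem setVar_setVar (e : Env) (y k l : ℕ) : (e.setVar y k).setVar y l = e.setVar y l := by
  simp [setVar]

@[simp] theorem setVar_var (e : Env) (y : ℕ) : e.setVar y (e.var y) = e := by
  simp [setVar]

end Env

/-- The memory `σ` holds the environment `e`. -/
structure Matches (e : Env) (σ : Mem) : Prop where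
  n : σ.nat 0 0 = e.data.n
  ty : σ.nat 1 = e.data.ty
  B : σ.real 0 0 = e.data.B
  v : σ.real 1 = e.data.v
  c : σ.real 2 = e.data.c
  var : σ.nat 3 = e.var

/-- The outputs and the intermediate results below level `d` are the same in `σ` and `τ`. -/
structure Frame (d : ℕ) (σ τ : Mem) : Prop where
  win : τ.nat 2 = σ.nat 2
  pay : τ.real 3 = σ.real 3
  nat : ∀ j < d, τ.nat 4 j = σ.nat 4 j
  real : ∀ j < d, τ.real 4 j = σ.real 4 j

theorem Frame.trans {d : ℕ} {σ τ υ : Mem} (h : Frame d σ τ) (h' : Frame d τ υ) : Frame d σ υ :=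
  ⟨h'.win.trans h.win, h'.pay.trans h.pay, fun j hj => (h'.nat j hj).trans (h.nat j hj),
    fun j hj => (h'.real j hj).trans (h.real j hj)⟩

theorem Frame.mono {d d' : ℕ} {σ τ : Mem} (h : Frame d' σ τ) (hd : d ≤ d') : Frame d σ τ :=
  ⟨h.win, h.pay, fun j hj => h.nat j (hj.trans_le hd), fun j hj => h.real j (hj.trans_le hd)⟩

theorem Matches.setReal_temp {e : Env} {σ : Mem} (h : Matches e σ) (d : ℕ) (x : ℝ) :
    Matches e (σ.setReal 4 d x) :=
  ⟨h.n, h.ty, by simp [Mem.setReal, h.B], by simp [Mem.setReal, h.v], by simp [Mem.setReal, h.c],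
    h.var⟩

theorem Matches.setNat_temp {e : Env} {σ : Mem} (h : Matches e σ) (d k : ℕ) :
    Matches e (σ.setNat 4 d k) :=
  ⟨by simp [Mem.setNat, h.n], by simp [Mem.setNat, h.ty], h.B, h.v, h.c,
    by simp [Mem.setNat, h.var]⟩

theorem Matches.setNat_var {e : Env} {σ : Mem} (h : Matches e σ) (y k : ℕ) :
    Matches (e.setVar y k) (σ.setNat 3 y k) :=
  ⟨by simp [Mem.setNat, h.n], by simp [Mem.setNat, h.ty], h.B, h.v, h.c,
    by simp [Mem.setNat, h.var, Env.setVar]⟩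

theorem Frame.setReal_temp (σ : Mem) (d : ℕ) (x : ℝ) : Frame d σ (σ.setReal 4 d x) :=
  ⟨rfl, by simp [Mem.setReal], fun _ _ => rfl, fun j hj => by simp [Mem.setReal, hj.ne]⟩

theorem Frame.setNat_temp (σ : Mem) (d k : ℕ) : Frame d σ (σ.setNat 4 d k) :=
  ⟨by simp [Mem.setNat], rfl, fun j hj => by simp [Mem.setNat, hj.ne], fun _ _ => rfl⟩

theorem Frame.setNat_var (σ : Mem) (d y k : ℕ) : Frame d σ (σ.setNat 3 y k) :=
  ⟨by simp [Mem.setNat], rfl, fun j hj => by simp [Mem.setNat], fun _ _ => rfl⟩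

/-- For every level `d` there is a program that leaves `f` of the environment in the real cell `d`
of array `4` and disturbs nothing below, in time polynomial in the number of items. -/
def Computes (f : Env → ℝ) : Prop :=
  ∃ p : Polynomial ℕ, ∀ d : ℕ, ∃ P : Prog, ∀ (e : Env) (σ : Mem), Matches e σ →
    ∃ (s : ℕ) (τ : Mem), Runs P σ s τ ∧ s ≤ p.eval e.data.n ∧ Matches e τ ∧ Frame d σ τ ∧
      τ.real 4 d = f e

/-- An index that can be written as an expression. -/
def Index (g : Env → ℕ) : Prop :=
  ∃ x : NExp, ∀ (e : Env) (σ : Mem), Matches e σ → x.eval σ = g e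

/-- The truth value of a proposition as a real number. -/
noncomputable def truth (p : Prop) : ℝ := open scoped Classical in if p then 1 else 0

def Decides (p : Env → Prop) : Prop := Computes fun e => truth (p e)

theorem Index.var (x : ℕ) : Index fun e => e.var x :=
  ⟨.get 3 (.const x), fun _ _ h => by simp [NExp.eval, h.var]⟩

theorem Index.card : Index fun e => e.data.n :=
  ⟨.get 0 (.const 0), fun _ _ h => by simp [NExp.eval, h.n]⟩

theorem Index.type {g : Env → ℕ} (hg : Index g) : Index fun e => e.data.ty (g e) := by
  obtain ⟨x, hx⟩ := hg
  exact ⟨.get 1 x, fun e σ h => by simp [NExp.eval, h.ty, hx e σ h]⟩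

theorem Index.succ {g : Env → ℕ} (hg : Index g) : Index fun e => g e + 1 := by
  obtain ⟨x, hx⟩ := hg
  exact ⟨.add x (.const 1), fun e σ h => by simp [NExp.eval, hx e σ h]⟩

namespace Computes

theorem of_exp {f : Env → ℝ} (x : RExp)
    (hx : ∀ (e : Env) (σ : Mem), Matches e σ → x.eval σ = f e) : Computes f := by
  refine ⟨Polynomial.C (x.cost + 2), fun d => ⟨.setReal 4 (.const d) x, fun e σ h => ?_⟩⟩
  refine ⟨_, _, Runs.setReal σ 4 (.const d) x, ?_, h.setReal_temp _ _,
    Frame.setReal_temp _ _ _, ?_⟩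
  · simp only [NExp.cost, Polynomial.eval_C]
    omega
  · simp [Mem.setReal, NExp.eval, hx e σ h]

theorem const (q : ℚ) : Computes fun _ => (q : ℝ) :=
  of_exp (.const q) fun _ _ _ => rfl

theorem one : Computes fun _ => 1 := by simpa using const 1

theorem zero : Computes fun _ => 0 := by simpa using const 0

theorem sqrtTwo : Computes fun _ => √2 :=
  of_exp (.sqrt (.const 2)) fun _ _ _ => by simp [RExp.eval]

theorem budget : Computes fun e => e.data.B :=
  of_exp (.get 0 (.const 0)) fun _ _ h => by simp [RExp.eval, NExp.eval, h.B]

theorem value {g : Env → ℕ} (hg : Index g) : Computes fun e => e.data.v (g e) := by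
  obtain ⟨x, hx⟩ := hg
  exact of_exp (.get 1 x) fun e σ h => by simp [RExp.eval, h.v, hx e σ h]

theorem cost {g : Env → ℕ} (hg : Index g) : Computes fun e => e.data.c (g e) := by
  obtain ⟨x, hx⟩ := hg
  exact of_exp (.get 2 x) fun e σ h => by simp [RExp.eval, h.c, hx e σ h]

theorem binary {f g : Env → ℝ} (hf : Computes f) (hg : Computes g) (op : ℝ → ℝ → ℝ)
    (op' : RExp → RExp → RExp) (heval : ∀ x y σ, (op' x y).eval σ = op (x.eval σ) (y.eval σ))
    (hcost : ∀ x y, (op' x y).cost = x.cost + y.cost + 1) :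
    Computes fun e => op (f e) (g e) := by
  obtain ⟨p, hp⟩ := hf
  obtain ⟨q, hq⟩ := hg
  refine ⟨p + q + 7, fun d => ?_⟩
  obtain ⟨P, hP⟩ := hp d
  -- One level up, so that the first operand in cell `d` survives.
  obtain ⟨Q, hQ⟩ := hq (d + 1)
  refine ⟨.seq (.seq P Q) (.setReal 4 (.const d)
    (op' (.get 4 (.const d)) (.get 4 (.const (d + 1))))), fun e σ h => ?_⟩
  obtain ⟨s, τ, hr, hs, hm, hfr, hv⟩ := hP e σ h
  obtain ⟨s', τ', hr', hs', hm', hfr', hv'⟩ := hQ e τ hm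
  refine ⟨_, _, (hr.seq hr').seq (Runs.setReal τ' 4 _ _), ?_, hm'.setReal_temp _ _,
    (hfr.trans (hfr'.mono (Nat.le_succ d))).trans (Frame.setReal_temp _ _ _), ?_⟩
  · simp only [NExp.cost, hcost, RExp.cost, Polynomial.eval_add, Polynomial.eval_ofNat]
    omega
  · simp [Mem.setReal, NExp.eval, heval, RExp.eval, hv', hfr'.real d (Nat.lt_succ_self d), hv]

theorem add {f g : Env → ℝ} (hf : Computes f) (hg : Computes g) : Computes fun e => f e + g e :=
  hf.binary hg (· + ·) .add (fun _ _ _ => rfl) fun _ _ => rfl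

theorem mul {f g : Env → ℝ} (hf : Computes f) (hg : Computes g) : Computes fun e => f e * g e :=
  hf.binary hg (· * ·) .mul (fun _ _ _ => rfl) fun _ _ => rfl

theorem div {f g : Env → ℝ} (hf : Computes f) (hg : Computes g) : Computes fun e => f e / g e :=
  hf.binary hg (· / ·) .div (fun _ _ _ => rfl) fun _ _ => rfl

theorem ite_le {f g u w : Env → ℝ} (hf : Computes f) (hg : Computes g) (hu : Computes u)
    (hw : Computes w) : Computes fun e => if f e ≤ g e then u e else w e := by
  obtain ⟨p, hp⟩ := hf
  obtain ⟨q, hq⟩ := hg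
  obtain ⟨p', hp'⟩ := hu
  obtain ⟨q', hq'⟩ := hw
  refine ⟨p + q + p' + q' + 6, fun d => ?_⟩
  obtain ⟨P, hP⟩ := hp d
  obtain ⟨Q, hQ⟩ := hq (d + 1)
  obtain ⟨P', hP'⟩ := hp' d
  obtain ⟨Q', hQ'⟩ := hq' d
  refine ⟨.seq (.seq P Q) (.cond (.realLe (.get 4 (.const d)) (.get 4 (.const (d + 1)))) P' Q'),
    fun e σ h => ?_⟩
  obtain ⟨s, τ, hr, hs, hm, hfr, hv⟩ := hP e σ h
  obtain ⟨s', τ', hr', hs', hm', hfr', hv'⟩ := hQ e τ hm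
  have hfr2 := hfr.trans (hfr'.mono (Nat.le_succ d))
  have htest : Test.Holds τ' (.realLe (.get 4 (.const d)) (.get 4 (.const (d + 1)))) ↔
      f e ≤ g e := by
    simp [Test.Holds, NExp.eval, RExp.eval, hv', hfr'.real d (Nat.lt_succ_self d), hv]
  by_cases hle : f e ≤ g e
  · obtain ⟨t, υ, hr2, ht, hm2, hfr3, hv2⟩ := hP' e τ' hm'
    refine ⟨_, υ, (hr.seq hr').seq (Runs.cond_true (htest.2 hle) hr2), ?_, hm2,
      hfr2.trans hfr3, hv2.trans (if_pos hle).symm⟩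
    simp only [NExp.cost, RExp.cost, Test.cost, Polynomial.eval_add, Polynomial.eval_ofNat]
    omega
  · obtain ⟨t, υ, hr2, ht, hm2, hfr3, hv2⟩ := hQ' e τ' hm'
    refine ⟨_, υ, (hr.seq hr').seq (Runs.cond_false (fun h => hle (htest.1 h)) hr2), ?_, hm2,
      hfr2.trans hfr3, hv2.trans (if_neg hle).symm⟩
    simp only [NExp.cost, RExp.cost, Test.cost, Polynomial.eval_add, Polynomial.eval_ofNat]
    omega

end Computes

/-- The test "`k < n`" of a loop with the index variable `y`. -/
def belowCard (y : ℕ) : Test :=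
  .natLe (.add (.get 3 (.const y)) (.const 1)) (.get 0 (.const 0))

/-- `k := k + 1` for the index variable `y`. -/
def incr (y : ℕ) : Prog := .setNat 3 (.const y) (.add (.get 3 (.const y)) (.const 1))

/-- The loop test costs 7 and the loop step 1, which accounts for the 8 per iteration and for the
final failed test. -/
theorem runs_for {y n T : ℕ} {body : Prog} {Inv : ℕ → Mem → Prop}
    (hInv : ∀ k σ, Inv k σ → σ.nat 3 y = k ∧ σ.nat 0 0 = n)
    (hbody : ∀ k < n, ∀ σ, Inv k σ → ∃ s τ, Runs body σ s τ ∧ s ≤ T ∧ Inv (k + 1) τ) :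
    ∀ m k σ, k + m = n → Inv k σ →
      ∃ s τ, Runs (.loop (belowCard y) body) σ s τ ∧ s ≤ m * (T + 8) + 8 ∧ Inv n τ := by
  have htest : ∀ k σ, Inv k σ → (Test.Holds σ (belowCard y) ↔ k < n) := fun k σ h => by
    simp only [belowCard, Test.Holds, NExp.eval, (hInv k σ h).1, (hInv k σ h).2]
    omega
  have hc : (belowCard y).cost = 7 := rfl
  intro m
  induction m with
  | zero =>
    intro k σ hk h
    obtain rfl : k = n := by omega
    exact ⟨_, σ, Runs.loop_false fun h' => absurd ((htest _ σ h).1 h') (lt_irrefl _),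
      by omega, h⟩
  | succ m ih =>
    intro k σ hk h
    obtain ⟨s, τ, hr, hs, hτ⟩ := hbody k (by omega) σ h
    obtain ⟨t, υ, hr', ht, hυ⟩ := ih (k + 1) τ (by omega) hτ
    refine ⟨_, υ, Runs.loop_true ((htest k σ h).2 (by omega)) hr hr', ?_, hυ⟩
    rw [hc, Nat.succ_mul]
    omega

namespace Computes

/-- The old value of `y` is saved in natural cell `d` and restored at the end, the sum accumulates
in real cell `d`, and the body works at level `d + 1`. Since the environment is restored, loops may
be nested and variables reused. -/
theorem sum_setVar {f : Env → ℝ} (hf : Computes f) (y : ℕ) :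
    Computes fun e => ∑ k ∈ Finset.range e.data.n, f (e.setVar y k) := by
  obtain ⟨p, hp⟩ := hf
  refine ⟨Polynomial.X * (p + 21) + 24, fun d => ?_⟩
  obtain ⟨P, hP⟩ := hp (d + 1)
  let body : Prog := .seq (.seq P (.setReal 4 (.const d)
    (.add (.get 4 (.const d)) (.get 4 (.const (d + 1)))))) (incr y)
  refine ⟨.seq (.seq (.seq (.seq (.setNat 4 (.const d) (.get 3 (.const y)))
    (.setReal 4 (.const d) (.const 0))) (.setNat 3 (.const y) (.const 0)))
    (.loop (belowCard y) body)) (.setNat 3 (.const y) (.get 4 (.const d))), fun e σ h => ?_⟩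
  let Inv : ℕ → Mem → Prop := fun k τ => Matches (e.setVar y k) τ ∧ Frame d σ τ ∧
    τ.nat 4 d = e.var y ∧ τ.real 4 d = ∑ j ∈ Finset.range k, f (e.setVar y j)
  have hInv : ∀ k τ, Inv k τ → τ.nat 3 y = k ∧ τ.nat 0 0 = e.data.n := fun k τ h =>
    ⟨by simp [h.1.var], by simp [h.1.n]⟩
  have hbody : ∀ k < e.data.n, ∀ τ, Inv k τ →
      ∃ s υ, Runs body τ s υ ∧ s ≤ p.eval e.data.n + 13 ∧ Inv (k + 1) υ := by
    rintro k - τ ⟨hm, hfr, hsave, hacc⟩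
    obtain ⟨s, υ, hr, hs, hm', hfr', hv⟩ := hP _ τ hm
    refine ⟨_, _, (hr.seq (Runs.setReal υ 4 _ _)).seq (Runs.setNat _ 3 _ _), ?_, ?_, ?_, ?_, ?_⟩
    · simp only [NExp.cost, RExp.cost]
      simp only [Env.setVar_data] at hs
      omega
    · have := (hm'.setReal_temp d (υ.real 4 d + f (e.setVar y k))).setNat_var y (k + 1)
      rw [Env.setVar_setVar] at this
      convert this using 2 <;> simp [NExp.eval, RExp.eval, Mem.setReal, hv, hm'.var]
    · exact ((hfr.trans (hfr'.mono (Nat.le_succ d))).trans (Frame.setReal_temp _ _ _)).trans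
        (Frame.setNat_var _ _ _ _)
    · have := hfr'.nat d (Nat.lt_succ_self d)
      simp [Mem.setNat, Mem.setReal, this, hsave]
    · have := hfr'.real d (Nat.lt_succ_self d)
      simp [Mem.setNat, Mem.setReal, NExp.eval, RExp.eval, this, hacc, hv, Finset.sum_range_succ]
  have h0 : Inv 0 (((σ.setNat 4 d (e.var y)).setReal 4 d 0).setNat 3 y 0) := by
    refine ⟨((h.setNat_temp _ _).setReal_temp _ _).setNat_var _ _,
      ((Frame.setNat_temp _ _ _).trans (Frame.setReal_temp _ _ _)).trans
        (Frame.setNat_var _ _ _ _), ?_, ?_⟩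
    · simp [Mem.setNat, Mem.setReal]
    · simp [Mem.setNat, Mem.setReal]
  obtain ⟨s, τ, hr, hs, hm, hfr, hsave, hacc⟩ :=
    runs_for hInv hbody e.data.n 0 _ (zero_add _) h0
  have hstart := ((Runs.setNat σ 4 (.const d) (.get 3 (.const y))).seq
    (Runs.setReal _ 4 (.const d) (.const 0))).seq (Runs.setNat _ 3 (.const y) (.const 0))
  simp only [NExp.eval, RExp.eval, h.var, Rat.cast_zero] at hstart
  refine ⟨_, _, (hstart.seq hr).seq (Runs.setNat τ 3 (.const y) (.get 4 (.const d))),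
    ?_, ?_, ?_, ?_⟩
  · simp only [NExp.cost, RExp.cost, Polynomial.eval_add, Polynomial.eval_mul, Polynomial.eval_X,
      Polynomial.eval_ofNat]
    rw [add_assoc] at hs
    norm_num at hs
    omega
  · have := hm.setNat_var y (e.var y)
    rw [Env.setVar_setVar, Env.setVar_var] at this
    simpa [NExp.eval, hsave] using this
  · exact hfr.trans (Frame.setNat_var _ _ _ _)
  · simpa [Mem.setNat] using hacc

/-- Sums over the items; `y` is an index variable on which `f` does not depend. -/
theorem sum {f : Env → ℕ → ℝ} (y : ℕ) (hy : ∀ e k, f (e.setVar y k) = f e)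
    (hf : Computes fun e => f e (e.var y)) :
    Computes fun e => ∑ k ∈ Finset.range e.data.n, f e k := by
  simpa [hy] using hf.sum_setVar y

theorem ite {p : Env → Prop} {_ : ∀ e, Decidable (p e)} {u w : Env → ℝ} (hp : Decides p)
    (hu : Computes u) (hw : Computes w) : Computes fun e => if p e then u e else w e := by
  convert one.ite_le hp hu hw using 4 with e
  by_cases h : p e <;> simp [truth, h]

theorem min {f g : Env → ℝ} (hf : Computes f) (hg : Computes g) :
    Computes fun e => min (f e) (g e) := by
  simpa only [min_def] using hf.ite_le hg hf hg

end Computes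

theorem Decides.congr {p q : Env → Prop} (hp : Decides p) (h : ∀ e, q e ↔ p e) : Decides q := by
  rwa [show q = p from funext fun e => propext (h e)]

theorem Computes.le {f g : Env → ℝ} (hf : Computes f) (hg : Computes g) :
    Decides fun e => f e ≤ g e := by
  unfold Decides
  convert hf.ite_le hg .one .zero using 2 with e
  by_cases h : f e ≤ g e <;> simp [truth, h]

theorem Index.le {g h : Env → ℕ} (hg : Index g) (hh : Index h) : Decides fun e => g e ≤ h e := by
  obtain ⟨x, hx⟩ := hg
  obtain ⟨y, hy⟩ := hh
  refine ⟨Polynomial.C (x.cost + y.cost + 5), fun d => ⟨.cond (.natLe x y)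
    (.setReal 4 (.const d) (.const 1)) (.setReal 4 (.const d) (.const 0)), fun e σ hm => ?_⟩⟩
  have htest : Test.Holds σ (.natLe x y) ↔ g e ≤ h e := by
    simp [Test.Holds, hx e σ hm, hy e σ hm]
  by_cases hle : g e ≤ h e
  · refine ⟨_, _, Runs.cond_true (htest.2 hle) (Runs.setReal _ _ _ _), ?_, hm.setReal_temp _ _,
      Frame.setReal_temp _ _ _, ?_⟩
    · simp only [Test.cost, NExp.cost, RExp.cost, Polynomial.eval_C]
      omega
    · simp [Mem.setReal, NExp.eval, RExp.eval, truth, hle]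
  · refine ⟨_, _, Runs.cond_false (fun h => hle (htest.1 h)) (Runs.setReal _ _ _ _), ?_,
      hm.setReal_temp _ _, Frame.setReal_temp _ _ _, ?_⟩
    · simp only [Test.cost, NExp.cost, RExp.cost, Polynomial.eval_C]
      omega
    · simp [Mem.setReal, NExp.eval, RExp.eval, truth, hle]

/-! ### Boolean combinations and quantifiers over items -/

namespace Decides

theorem not {p : Env → Prop} (hp : Decides p) : Decides fun e => ¬ p e := by
  refine (Computes.le hp .zero).congr fun e => ?_
  by_cases h : p e <;> simp [truth, h]

theorem and {p q : Env → Prop} (hp : Decides p) (hq : Decides q) :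
    Decides fun e => p e ∧ q e := by
  refine (Computes.le .one (Computes.mul hp hq)).congr fun e => ?_
  by_cases h : p e <;> by_cases h' : q e <;> simp [truth, h, h']

theorem or {p q : Env → Prop} (hp : Decides p) (hq : Decides q) :
    Decides fun e => p e ∨ q e :=
  (hp.not.and hq.not).not.congr fun e => by tauto

theorem imp {p q : Env → Prop} (hp : Decides p) (hq : Decides q) :
    Decides fun e => p e → q e :=
  (hp.and hq.not).not.congr fun e => by tauto

/-- Quantifiers over the items; `y` is an index variable on which `p` does not depend. -/
theorem forall_lt {p : Env → ℕ → Prop} (y : ℕ) (hy : ∀ e k, p (e.setVar y k) = p e)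
    (hp : Decides fun e => p e (e.var y)) : Decides fun e => ∀ k < e.data.n, p e k := by
  -- The sum counts counterexamples; the statement holds when the count is at most 0.
  have := Computes.sum (f := fun e k => truth (¬ p e k)) y (fun e k => by simp [hy]) hp.not
  refine (this.le .zero).congr fun e => ?_
  have hnn : ∀ k ∈ Finset.range e.data.n, 0 ≤ truth (¬ p e k) := fun k _ => by
    unfold truth
    split_ifs <;> norm_num
  rw [(Finset.sum_nonneg hnn).ge_iff_eq', Finset.sum_eq_zero_iff_of_nonneg hnn]
  simp [truth]

theorem exists_lt {p : Env → ℕ → Prop} (y : ℕ) (hy : ∀ e k, p (e.setVar y k) = p e)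
    (hp : Decides fun e => p e (e.var y)) : Decides fun e => ∃ k < e.data.n, p e k :=
  (forall_lt (p := fun e k => ¬ p e k) y (fun e k => by simp [hy]) hp.not).not.congr
    fun e => by simp

end Decides

theorem Computes.lt {f g : Env → ℝ} (hf : Computes f) (hg : Computes g) :
    Decides fun e => f e < g e :=
  (hg.le hf).not.congr fun _ => not_le.symm

theorem Computes.eq {f g : Env → ℝ} (hf : Computes f) (hg : Computes g) :
    Decides fun e => f e = g e :=
  ((hf.le hg).and (hg.le hf)).congr fun _ => le_antisymm_iff

theorem Index.eq {g h : Env → ℕ} (hg : Index g) (hh : Index h) : Decides fun e => g e = h e :=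
  ((hg.le hh).and (hh.le hg)).congr fun _ => le_antisymm_iff

theorem Index.lt {g h : Env → ℕ} (hg : Index g) (hh : Index h) : Decides fun e => g e < h e :=
  (hg.succ.le hh).congr fun _ => Iff.rfl

/-! ### Programs for the greedy rule and the test -/

/-- `Q` has to be decided at both the candidate `x` and the bound variable `y`, hence the hypothesis
for every index variable. -/
theorem Decides.top {Q : Env → ℕ → Prop} (hQ : ∀ x, Decides fun e => Q e (e.var x)) (x y : ℕ)
    (hxy : x ≠ y) (hy : ∀ e k, Q (e.setVar y k) = Q e) :
    Decides fun e => e.data.Top (Q e) (e.var x) := by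
  refine (hQ x).and (forall_lt (p := fun e k => Q e k → e.data.ty k = e.data.ty (e.var x) →
    e.data.v k < e.data.v (e.var x) ∨ (e.data.v k = e.data.v (e.var x) ∧ e.var x ≤ k)) y ?_ ?_)
  · intro e k
    simp [hy, Env.setVar_var_of_ne _ _ hxy]
  · have hvx := Computes.value (Index.var x)
    have hvy := Computes.value (Index.var y)
    exact (hQ y).imp (((Index.var y).type.eq (Index.var x).type).imp
      ((hvy.lt hvx).or ((hvy.eq hvx).and ((Index.var x).le (Index.var y)))))

theorem Computes.hull {Q : Env → ℕ → Prop} (hQ : ∀ x, Decides fun e => Q e (e.var x)) (x y : ℕ)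
    (hxy : x ≠ y) (hx : ∀ e k, Q (e.setVar x k) = Q e) (hy : ∀ e k, Q (e.setVar y k) = Q e) :
    Computes fun e => e.data.hull (Q e) := by
  classical
  exact Computes.sum (f := fun e j => if e.data.Top (Q e) j then e.data.v j else 0) x
    (fun e k => by simp [hx]) (.ite (Decides.top hQ x y hxy hy) (.value (.var x)) .zero)

theorem decides_active (x : ℕ) : Decides fun e => e.data.Active (e.var x) :=
  ((Index.var x).lt .card).and
    ((Computes.zero.lt (.value (.var x))).and ((Computes.cost (.var x)).le .budget))

theorem computes_rate (x : ℕ) : Computes fun e => e.data.rate (e.var x) :=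
  (Computes.cost (.var x)).div (.value (.var x))

theorem decides_before (x y : ℕ) : Decides fun e => e.data.Before (e.var x) (e.var y) :=
  ((computes_rate x).lt (computes_rate y)).or
    (((computes_rate x).eq (computes_rate y)).and ((Index.var x).le (.var y)))

theorem decides_accepted (x : ℕ) : Decides fun e => e.data.Accepted (e.var x) := by
  refine (decides_active x).and (((computes_rate x).mul ?_).le .budget)
  -- The prefix depends on the variable `x`, so the hull needs two other variables for its loops.
  refine Computes.hull (Q := fun e k => e.data.Active k ∧ e.data.Before k (e.var x))
    (fun z => (decides_active z).and (decides_before z x)) (x + 1) (x + 2) (by omega) ?_ ?_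
  · intro e k
    simp [Env.setVar_var_of_ne]
  · intro e k
    simp [Env.setVar_var_of_ne]

theorem decides_rejected (x : ℕ) : Decides fun e => e.data.Rejected (e.var x) :=
  (decides_active x).and (decides_accepted x).not

theorem decides_firstRejected (x : ℕ) : Decides fun e => e.data.FirstRejected (e.var x) :=
  (decides_rejected x).and (.forall_lt (p := fun e j => e.data.Rejected j →
      e.data.Before (e.var x) j) (x + 1) (fun e k => by simp [Env.setVar_var_of_ne])
    ((decides_rejected (x + 1)).imp (decides_before x (x + 1))))

theorem decides_top_accepted (x : ℕ) : Decides fun e => e.data.Top e.data.Accepted (e.var x) :=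
  .top decides_accepted x (x + 1) (by omega) fun _ _ => rfl

theorem computes_total : Computes fun e => e.data.total :=
  .hull decides_accepted 0 1 (by omega) (fun _ _ => rfl) fun _ _ => rfl

theorem computes_price : Computes fun e => e.data.price := by
  unfold Data.price
  refine .ite (.exists_lt (p := fun e k => e.data.Rejected k) 0 (fun _ _ => rfl)
    (decides_rejected 0)) ?_ (Computes.budget.div computes_total)
  refine .sum 0 (fun _ _ => rfl) ?_
  exact .ite (decides_firstRejected 0)
    ((computes_rate 0).min (Computes.budget.div computes_total)) .zero

theorem decides_star (x : ℕ) : Decides fun e => e.data.Star (e.var x) := by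
  refine (decides_active x).and (.forall_lt (p := fun e k => e.data.Active k →
    e.data.v k < e.data.v (e.var x) ∨ (e.data.v k = e.data.v (e.var x) ∧ e.var x ≤ k))
    (x + 1) (fun e k => by simp [Env.setVar_var_of_ne]) ?_)
  have hvx := Computes.value (Index.var x)
  have hvy := Computes.value (Index.var (x + 1))
  exact (decides_active (x + 1)).imp
    ((hvy.lt hvx).or ((hvy.eq hvx).and ((Index.var x).le (Index.var (x + 1)))))

theorem computes_starValue : Computes fun e => e.data.starValue := by
  unfold Data.starValue
  exact .sum 0 (fun _ _ => rfl) (.ite (decides_star 0) (.value (.var 0)) .zero)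

theorem computes_halfSqrtTwo : Computes fun _ => √2 / 2 := by
  simpa using Computes.sqrtTwo.div (.const 2)

theorem computes_testRate : Computes fun e => e.data.testRate :=
  Computes.budget.div ((Computes.one.add computes_halfSqrtTwo).mul computes_starValue)

theorem decides_cheap (x : ℕ) : Decides fun e => e.data.Cheap (e.var x) :=
  (decides_active x).and ((decides_star x).not.and ((computes_rate x).le computes_testRate))

theorem decides_preferGreedy : Decides fun e => e.data.PreferGreedy :=
  (computes_halfSqrtTwo.mul computes_starValue).lt
    (.hull decides_cheap 0 1 (by omega) (fun _ _ => rfl) fun _ _ => rfl)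

theorem decides_pivotal (x : ℕ) : Decides fun e => e.data.Pivotal (e.var x) := by
  refine ((computes_halfSqrtTwo.mul computes_starValue).lt ?_).not
  refine Computes.hull (Q := fun e j => e.data.Cheap j ∧ ¬ j = e.var x)
    (fun z => (decides_cheap z).and ((Index.var z).eq (.var x)).not) (x + 1) (x + 2)
    (by omega) ?_ ?_
  · intro e k
    simp [Env.setVar_var_of_ne]
  · intro e k
    simp [Env.setVar_var_of_ne]

end HetKnapsack

namespace HetKnapsack

open RealRAM

/-! ### Mechanisms from rules -/

/-- The data of a market with bids, extended by zero. -/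
noncomputable def Market.toData (I : Market) (b : Fin I.n → ℝ) : Data where
  n := I.n
  ty k := if h : k < I.n then (I.type ⟨k, h⟩ : ℕ) else 0
  B := I.budget
  v k := if h : k < I.n then I.value ⟨k, h⟩ else 0
  c k := if h : k < I.n then b ⟨k, h⟩ else 0

section toData

variable {I : Market} {b : Fin I.n → ℝ}

@[simp] theorem toData_n : (I.toData b).n = I.n := rfl

@[simp] theorem toData_B : (I.toData b).B = I.budget := rfl

@[simp] theorem toData_ty (i : Fin I.n) : (I.toData b).ty i = I.type i := by
  simp [Market.toData]

@[simp] theorem toData_v (i : Fin I.n) : (I.toData b).v i = I.value i := by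
  simp [Market.toData]

@[simp] theorem toData_c (i : Fin I.n) : (I.toData b).c i = b i := by
  simp [Market.toData]

theorem toData_valid (hb : ∀ i, 0 ≤ b i) : (I.toData b).Valid where
  v_nonneg k := by
    unfold Market.toData
    dsimp only
    split_ifs
    exacts [I.value_nonneg _, le_rfl]
  c_nonneg k := by
    unfold Market.toData
    dsimp only
    split_ifs
    exacts [hb _, le_rfl]
  B_pos := I.budget_pos

theorem toData_update (i : Fin I.n) (x : ℝ) :
    I.toData (Function.update b i x) = (I.toData b).setCost i x := by
  simp only [Market.toData, Data.setCost, Data.mk.injEq, true_and]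
  funext k
  by_cases hk : k = i
  · subst hk
    simp
  · have : ∀ h : k < I.n, (⟨k, h⟩ : Fin I.n) ≠ i := fun h h' => hk (congrArg Fin.val h')
    simp [hk, this]

theorem opt_le {K : ℝ}
    (h : ∀ T, (I.toData b).Solution T → ∑ i ∈ T, (I.toData b).v i ≤ K) : I.opt b ≤ K := by
  classical
  unfold Market.opt
  refine Finset.sup'_le _ _ fun S hS => ?_
  obtain ⟨h1, h2⟩ : I.Feasible b S := by simpa using hS
  refine le_trans (le_of_eq ?_) (h (S.map Fin.valEmbedding) ⟨?_, ?_, ?_⟩)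
  · simp [Market.val]
  · simp only [Finset.mem_map, Fin.valEmbedding_apply]
    rintro _ ⟨i, -, rfl⟩
    exact i.2
  · simp only [Finset.mem_map, Fin.valEmbedding_apply]
    rintro _ ⟨i, hi, rfl⟩ _ ⟨j, hj, rfl⟩ hij
    rw [toData_ty, toData_ty] at hij
    rw [h1 i hi j hj (Fin.ext hij)]
  · simpa using h2

end toData

/-- The winners and the payments as functions of the data. -/
structure Rule where
  wins : Data → ℕ → Prop
  pay : Data → ℕ → ℝ

namespace Rule

open scoped Classical in
/-- The mechanism that applies a rule to the bids. -/
noncomputable def mechanism (R : Rule) : Mechanism where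
  winners I b := Finset.univ.filter fun i : Fin I.n => R.wins (I.toData b) i
  pay I b i := R.pay (I.toData b) i

/-- The conditions on a rule under which its mechanism is truthful and budget feasible. -/
structure Sound (R : Rule) : Prop where
  distinct : ∀ (D : Data), D.Valid → ∀ i < D.n, ∀ j < D.n, R.wins D i → R.wins D j →
    D.ty i = D.ty j → i = j
  pay_eq_zero : ∀ (D : Data) (i : ℕ), ¬ R.wins D i → R.pay D i = 0
  cost_le_pay : ∀ (D : Data), D.Valid → ∀ i, R.wins D i → D.c i ≤ R.pay D i
  stable : ∀ (D : Data), D.Valid → ∀ (i : ℕ) (x : ℝ), R.wins D i → 0 ≤ x → x < R.pay D i →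
    R.wins (D.setCost i x) i ∧ R.pay (D.setCost i x) i = R.pay D i
  sum_pay_le : ∀ (D : Data), D.Valid → ∑ i ∈ Finset.range D.n, R.pay D i ≤ D.B

variable {R : Rule}

theorem mem_winners {I : Market} {b : Fin I.n → ℝ} {i : Fin I.n} :
    i ∈ R.mechanism.winners I b ↔ R.wins (I.toData b) i := by
  simp [mechanism]

theorem mechanism_pay (I : Market) (b : Fin I.n → ℝ) (i : Fin I.n) :
    R.mechanism.pay I b i = R.pay (I.toData b) i := rfl

theorem val_winners (I : Market) (b : Fin I.n → ℝ)
    {_ : ∀ i, Decidable (R.wins (I.toData b) i)} :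
    I.val (R.mechanism.winners I b) =
      ∑ i ∈ Finset.range (I.toData b).n, if R.wins (I.toData b) i then (I.toData b).v i else 0 := by
  rw [toData_n, Finset.sum_range, Market.val, mechanism, Finset.sum_filter]
  refine Finset.sum_congr rfl fun i _ => ?_
  rw [toData_v]
  congr

/-- Apply stability at the deviating profile, moving the bid back to the true cost. If a deviation
wins with payment above the true cost, truth wins with the same payment; otherwise the deviation
gains nothing and individual rationality suffices. -/
theorem Sound.truthful (h : R.Sound) : R.mechanism.Truthful := by
  intro I b hb i x hx
  have hD : (I.toData b).Valid := toData_valid hb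
  have hD' : ((I.toData b).setCost i x).Valid := hD.setCost hx
  have hback : ((I.toData b).setCost i x).setCost i (b i) = I.toData b := by
    rw [← toData_update, ← toData_update]
    simp
  have hir := h.cost_le_pay _ hD i
  have hst := h.stable _ hD' i (b i)
  rw [hback] at hst
  rw [toData_c] at hir
  classical
  simp only [Mechanism.utility, mem_winners, mechanism_pay, toData_update]
  by_cases hw' : R.wins ((I.toData b).setCost i x) i <;> by_cases hw : R.wins (I.toData b) i
  · rw [if_pos hw', if_pos hw]
    by_contra hlt
    have := (hst hw' (hb i) (by linarith [hir hw])).2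
    linarith
  · rw [if_pos hw', if_neg hw]
    by_contra hlt
    exact hw (hst hw' (hb i) (by linarith)).1
  · rw [if_neg hw', if_pos hw]
    linarith [hir hw]
  · rw [if_neg hw', if_neg hw]

theorem Sound.isTruthfulBudgetFeasible (h : R.Sound) :
    R.mechanism.IsTruthfulBudgetFeasible where
  distinctTypes I b hb i hi j hj hij := by
    rw [mem_winners] at hi hj
    refine Fin.ext (h.distinct _ (toData_valid hb) i i.2 j j.2 hi hj ?_)
    rw [toData_ty, toData_ty, hij]
  noPositiveTransfer I b _ i hi := h.pay_eq_zero _ _ fun hw => hi (mem_winners.2 hw)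
  individuallyRational I b hb i hi := by
    simpa [mechanism_pay] using h.cost_le_pay _ (toData_valid hb) i (mem_winners.1 hi)
  truthful := h.truthful
  budgetFeasible I b hb := by
    have := h.sum_pay_le _ (toData_valid hb)
    rwa [toData_n, Finset.sum_range] at this

theorem polynomial_eval_mono (p : Polynomial ℕ) {a b : ℕ} (h : a ≤ b) : p.eval a ≤ p.eval b := by
  rw [Polynomial.eval_eq_sum, Polynomial.eval_eq_sum]
  exact Finset.sum_le_sum fun k _ => Nat.mul_le_mul_left _ (Nat.pow_le_pow_left h k)

/-- One loop evaluates both outputs for each item. The output arrays are not among the data in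
`Matches`, and `Frame` protects results already written. -/
theorem polyTime (hw : Decides fun e => R.wins e.data (e.var 0))
    (hp : Computes fun e => R.pay e.data (e.var 0)) : R.mechanism.PolyTime := by
  classical
  obtain ⟨p, hp'⟩ := hw
  obtain ⟨q, hq'⟩ := hp
  obtain ⟨P, hP⟩ := hp' 0
  obtain ⟨Q, hQ⟩ := hq' 0
  let flag : Prog := .cond (.realLe (.const 1) (.get 4 (.const 0)))
    (.setNat 2 (.get 3 (.const 0)) (.const 1)) (.setNat 2 (.get 3 (.const 0)) (.const 0))
  let body : Prog := .seq (.seq (.seq (.seq P flag) Q)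
    (.setReal 3 (.get 3 (.const 0)) (.get 4 (.const 0)))) (incr 0)
  -- 28 is 9 for the flag, 5 for storing the payment, 6 for the increment and 8 for the loop.
  refine ⟨.loop (belowCard 0) body, Polynomial.X * (p + q + 28) + 8, fun I b hb => ?_⟩
  let e : Env := ⟨I.toData b, fun _ => 0⟩
  have hm0 : Matches e (inputMem I b) := by
    constructor <;> rfl
  let Inv : ℕ → Mem → Prop := fun k τ => Matches (e.setVar 0 k) τ ∧ ∀ i < k,
    τ.nat 2 i = (if R.wins (I.toData b) i then 1 else 0) ∧ τ.real 3 i = R.pay (I.toData b) i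
  have hInv : ∀ k τ, Inv k τ → τ.nat 3 0 = k ∧ τ.nat 0 0 = I.n := fun k τ h =>
    ⟨by simp [h.1.var], by simp [h.1.n, e]⟩
  have hbody : ∀ k < I.n, ∀ τ, Inv k τ →
      ∃ s υ, Runs body τ s υ ∧ s ≤ p.eval I.n + q.eval I.n + 20 ∧ Inv (k + 1) υ := by
    rintro k - σ ⟨hm, hout⟩
    obtain ⟨s₁, τ₁, hr₁, hs₁, hm₁, hfr₁, hv₁⟩ := hP _ σ hm
    have hk₁ : τ₁.nat 3 0 = k := by simp [hm₁.var]
    have hflag : Runs flag τ₁ 9 (τ₁.setNat 2 k (if R.wins (I.toData b) k then 1 else 0)) := by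
      have htest : Test.Holds τ₁ (.realLe (.const 1) (.get 4 (.const 0))) ↔
          R.wins (I.toData b) k := by
        simp only [Test.Holds, RExp.eval, NExp.eval, hv₁, truth, Env.setVar_data,
          Env.setVar_var_self, e]
        split_ifs with hw <;> simp [hw]
      by_cases hw : R.wins (I.toData b) k
      · have := Runs.cond_true (Q := .setNat 2 (.get 3 (.const 0)) (.const 0)) (htest.2 hw)
          (Runs.setNat τ₁ 2 (.get 3 (.const 0)) (.const 1))
        simpa [flag, NExp.eval, NExp.cost, RExp.cost, Test.cost, hk₁, hw] using this
      · have := Runs.cond_false (P := .setNat 2 (.get 3 (.const 0)) (.const 1))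
          (fun h => hw (htest.1 h)) (Runs.setNat τ₁ 2 (.get 3 (.const 0)) (.const 0))
        simpa [flag, NExp.eval, NExp.cost, RExp.cost, Test.cost, hk₁, hw] using this
    set σ₂ := τ₁.setNat 2 k (if R.wins (I.toData b) k then 1 else 0) with hσ₂
    have hm₂ : Matches (e.setVar 0 k) σ₂ :=
      ⟨by simp [hσ₂, Mem.setNat, hm₁.n], by simp [hσ₂, Mem.setNat, hm₁.ty], hm₁.B, hm₁.v, hm₁.c,
        by simp [hσ₂, Mem.setNat, hm₁.var]⟩
    obtain ⟨s₃, τ₃, hr₃, hs₃, hm₃, hfr₃, hv₃⟩ := hQ _ σ₂ hm₂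
    have hv₃' : τ₃.real 4 0 = R.pay (I.toData b) k := by simpa [e] using hv₃
    have hk₃ : τ₃.nat 3 0 = k := by simp [hm₃.var]
    have hr₄ : Runs (.setReal 3 (.get 3 (.const 0)) (.get 4 (.const 0))) τ₃ 5
        (τ₃.setReal 3 k (R.pay (I.toData b) k)) := by
      simpa [NExp.eval, RExp.eval, NExp.cost, RExp.cost, hk₃, hv₃'] using
        Runs.setReal τ₃ 3 (.get 3 (.const 0)) (.get 4 (.const 0))
    set σ₄ := τ₃.setReal 3 k (R.pay (I.toData b) k) with hσ₄
    have hm₄ : Matches (e.setVar 0 k) σ₄ :=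
      ⟨hm₃.n, hm₃.ty, by simp [hσ₄, Mem.setReal, hm₃.B], by simp [hσ₄, Mem.setReal, hm₃.v],
        by simp [hσ₄, Mem.setReal, hm₃.c], hm₃.var⟩
    have hr₅ : Runs (incr 0) σ₄ 6 (σ₄.setNat 3 0 (k + 1)) := by
      simpa [incr, NExp.eval, NExp.cost, hm₄.var] using
        Runs.setNat σ₄ 3 (.const 0) (.add (.get 3 (.const 0)) (.const 1))
    refine ⟨_, _, (((hr₁.seq hflag).seq hr₃).seq hr₄).seq hr₅, ?_, ?_, ?_⟩
    · simp only [Env.setVar_data, e, toData_n] at hs₁ hs₃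
      omega
    · simpa using hm₄.setNat_var 0 (k + 1)
    · intro i hi
      have hwin : (σ₄.setNat 3 0 (k + 1)).nat 2 = σ₂.nat 2 := by
        simp [Mem.setNat, hσ₄, Mem.setReal, hfr₃.win]
      have hpay : (σ₄.setNat 3 0 (k + 1)).real 3 =
          Function.update (σ.real 3) k (R.pay (I.toData b) k) := by
        have : σ₂.real 3 = σ.real 3 := hfr₁.pay
        simp [Mem.setNat, hσ₄, Mem.setReal, hfr₃.pay, this]
      rw [hwin, hpay]
      by_cases hik : i = k
      · subst hik
        simp [hσ₂, Mem.setNat]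
      · simpa [hσ₂, Mem.setNat, hik, hfr₁.win] using hout i (by omega)
  obtain ⟨s, τ, hr, hs, hτ⟩ := runs_for hInv hbody I.n 0 (inputMem I b) (zero_add _)
    ⟨by simpa [Env.setVar, e] using hm0, fun i hi => absurd hi (Nat.not_lt_zero i)⟩
  refine ⟨s, τ, hr, le_trans ?_ (polynomial_eval_mono _ (Nat.le_add_right I.n I.m)), fun i => ?_⟩
  · simp only [Polynomial.eval_add, Polynomial.eval_mul, Polynomial.eval_X, Polynomial.eval_ofNat]
    rwa [add_assoc (p.eval I.n + q.eval I.n)] at hs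
  · simpa [mem_winners, mechanism_pay] using hτ.2 i i.2

end Rule

end HetKnapsack

namespace HetKnapsack

/-! ### The mechanisms -/

namespace Rule

section

open scoped Classical in
/-- Buy the most valuable item. -/
noncomputable def star : Rule where
  wins D i := D.Star i
  pay D i := if D.Star i then D.B else 0

open scoped Classical in
/-- Buy the accepted items at a uniform price per unit of value. -/
noncomputable def greedy : Rule where
  wins D i := D.Top D.Accepted i
  pay D i := if D.Top D.Accepted i then D.v i * D.price else 0

open scoped Classical in
/-- Use the greedy rule if the cheap items are worth enough, and otherwise buy the most valuable
item.  An item without which the greedy rule would not be used is paid at most the test rate. -/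
noncomputable def choice : Rule where
  wins D i := if D.PreferGreedy then D.Top D.Accepted i else D.Star i
  pay D i :=
    if D.PreferGreedy then
      if D.Top D.Accepted i then
        D.v i * (if D.Pivotal i ∧ ¬ D.Star i then min D.price D.testRate else D.price)
      else 0
    else if D.Star i then D.B else 0

end

theorem sum_star_pay_le {D : Data} (hD : D.Valid) :
    ∑ i ∈ Finset.range D.n, star.pay D i ≤ D.B := by
  by_cases h : ∃ i, D.Star i
  · obtain ⟨i, hi⟩ := h
    refine le_of_eq ?_
    rw [Finset.sum_eq_single i]
    · exact if_pos hi
    · exact fun j _ hj => if_neg fun h => hj (h.eq hi)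
    · exact fun h => absurd (Finset.mem_range.2 hi.1.1) h
  · refine (Finset.sum_nonpos fun i _ => ?_).trans hD.B_pos.le
    exact (if_neg fun hi => h ⟨i, hi⟩).le

theorem sum_greedy_pay_le {D : Data} (hD : D.Valid) :
    ∑ i ∈ Finset.range D.n, greedy.pay D i ≤ D.B := by
  refine le_trans (le_of_eq ?_) (Data.price_mul_total_le hD)
  rw [Data.total, Data.hull, Finset.mul_sum]
  refine Finset.sum_congr rfl fun i _ => ?_
  simp only [greedy]
  split_ifs <;> simp [mul_comm]

theorem star_sound : star.Sound where
  distinct D hD i hi j hj h h' _ := h.eq h'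
  pay_eq_zero D i h := if_neg h
  cost_le_pay D hD i h := h.1.2.2.trans_eq (if_pos h).symm
  stable D hD i x h hx0 hx := by
    have hs : D.Star i := h
    have hB : star.pay D i = D.B := if_pos hs
    rw [hB] at hx ⊢
    have h' : (D.setCost i x).Star i := (Data.setCost_star hs.1 hx.le i).2 hs
    exact ⟨h', if_pos h'⟩
  sum_pay_le D hD := sum_star_pay_le hD

theorem greedy_sound : greedy.Sound where
  distinct D hD i hi j hj h h' hty := h.eq hi hj h' hty
  pay_eq_zero D i h := if_neg h
  cost_le_pay D hD i h := (h.1.cost_le hD).trans_eq (if_pos h).symm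
  stable D hD i x h hx0 hx := by
    have hs : D.Top D.Accepted i := h
    have hp : greedy.pay D i = D.v i * D.price := if_pos hs
    rw [hp] at hx ⊢
    have h' := (Data.setCost_top_accepted hD hs.1 hx0 hx i).2 hs
    refine ⟨h', (if_pos h').trans ?_⟩
    rw [Data.setCost_price hD hs.1 hx0 hx]
    rfl
  sum_pay_le D hD := sum_greedy_pay_le hD

theorem choice_wins_of_preferGreedy {D : Data} (h : D.PreferGreedy) (i : ℕ) :
    choice.wins D i ↔ D.Top D.Accepted i := by
  simp [choice, h]

theorem choice_wins_of_not_preferGreedy {D : Data} (h : ¬ D.PreferGreedy) (i : ℕ) :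
    choice.wins D i ↔ D.Star i := by
  simp [choice, h]

open scoped Classical in
theorem choice_pay_of_preferGreedy {D : Data} (h : D.PreferGreedy) {i : ℕ}
    (hi : D.Top D.Accepted i) : choice.pay D i =
      D.v i * (if D.Pivotal i ∧ ¬ D.Star i then min D.price D.testRate else D.price) := by
  simp [choice, h, hi]

theorem choice_pay_of_not_preferGreedy {D : Data} (h : ¬ D.PreferGreedy) (i : ℕ) :
    choice.pay D i = star.pay D i := by
  simp [choice, star, h]

theorem choice_pay_eq_zero (D : Data) (i : ℕ) (h : ¬ choice.wins D i) : choice.pay D i = 0 := by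
  by_cases hg : D.PreferGreedy
  · rw [choice_wins_of_preferGreedy hg] at h
    simp [choice, hg, h]
  · rw [choice_wins_of_not_preferGreedy hg] at h
    simp [choice, hg, h]

/-- The cap only lowers payments, so budget feasibility is inherited from the greedy rule. -/
theorem choice_pay_le {D : Data} (hD : D.Valid) (h : D.PreferGreedy) (i : ℕ) :
    choice.pay D i ≤ greedy.pay D i := by
  by_cases hi : D.Top D.Accepted i
  · have hp : greedy.pay D i = D.v i * D.price := if_pos hi
    rw [choice_pay_of_preferGreedy h hi, hp]
    refine mul_le_mul_of_nonneg_left ?_ (hD.v_nonneg i)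
    split_ifs
    exacts [min_le_left _ _, le_rfl]
  · rw [choice_pay_eq_zero D i ((choice_wins_of_preferGreedy h i).not.2 hi)]
    exact (if_neg hi).ge

/-- Removing an item that is not cheap cannot change the test. Cheapness makes the capped payment
cover the cost. -/
theorem cheap_of_pivotal {D : Data} (hD : D.Valid) (h : D.PreferGreedy) {i : ℕ}
    (hi : D.Pivotal i) : D.Cheap i := by
  by_contra hc
  refine hi (h.trans_le (Data.hull_mono hD fun j _ hj => ⟨hj, ?_⟩))
  rintro rfl
  exact hc hj

theorem choice_sound : choice.Sound where
  distinct D hD i hi j hj h h' hty := by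
    by_cases hg : D.PreferGreedy
    · rw [choice_wins_of_preferGreedy hg] at h h'
      exact h.eq hi hj h' hty
    · rw [choice_wins_of_not_preferGreedy hg] at h h'
      exact h.eq h'
  pay_eq_zero := choice_pay_eq_zero
  cost_le_pay D hD i h := by
    by_cases hg : D.PreferGreedy
    · rw [choice_wins_of_preferGreedy hg] at h
      have hv := h.1.1.2.1
      have hr := h.1.rate_le_price hD
      rw [choice_pay_of_preferGreedy hg h, mul_comm, ← div_le_iff₀ hv]
      split_ifs with hp
      · exact le_min hr (cheap_of_pivotal hD hg hp.1).2.2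
      · exact hr
    · rw [choice_wins_of_not_preferGreedy hg] at h
      rw [choice_pay_of_not_preferGreedy hg]
      exact star_sound.cost_le_pay D hD i h
  stable D hD i x h hx0 hx := by
    by_cases hg : D.PreferGreedy
    · rw [choice_wins_of_preferGreedy hg] at h
      have hx' : x < D.v i * D.price :=
        (hx.trans_le (choice_pay_le hD hg i)).trans_eq (if_pos h)
      have hxB : x ≤ D.B := hx'.le.trans (Data.value_mul_price_le hD h.1)
      have htop := (Data.setCost_top_accepted hD h.1 hx0 hx' i).2 h
      -- The bid of the star is not tested; for the others the cap supplies the bound needed when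
      -- they are pivotal.
      have hg' : (D.setCost i x).PreferGreedy := by
        by_cases hs : D.Star i
        · exact (Data.setCost_preferGreedy_of_star hs hxB).2 hg
        · refine Data.setCost_preferGreedy hD h.1.1 hxB hg fun hp => ?_
          rw [choice_pay_of_preferGreedy hg h, if_pos ⟨hp, hs⟩] at hx
          exact hx.le.trans (mul_le_mul_of_nonneg_left (min_le_right _ _) (hD.v_nonneg i))
      refine ⟨(choice_wins_of_preferGreedy hg' i).2 htop, ?_⟩
      rw [choice_pay_of_preferGreedy hg' htop, choice_pay_of_preferGreedy hg h,
        Data.setCost_price hD h.1 hx0 hx', Data.setCost_testRate h.1.1 hxB]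
      classical
      exact congrArg (D.v i * ·) (if_congr (and_congr (Data.setCost_pivotal h.1.1 hxB)
        (Data.setCost_star h.1.1 hxB i).not) rfl rfl)
    · rw [choice_wins_of_not_preferGreedy hg] at h
      rw [choice_pay_of_not_preferGreedy hg] at hx ⊢
      have hB : star.pay D i = D.B := if_pos h
      -- The star is paid `B`, so a lower bid leaves it active and the failed test unchanged.
      have hg' := (Data.setCost_preferGreedy_of_star h (hB ▸ hx.le)).not.2 hg
      rw [choice_wins_of_not_preferGreedy hg', choice_pay_of_not_preferGreedy hg']
      exact star_sound.stable D hD i x h hx0 hx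
  sum_pay_le D hD := by
    by_cases hg : D.PreferGreedy
    · exact (Finset.sum_le_sum fun i _ => choice_pay_le hD hg i).trans (sum_greedy_pay_le hD)
    · simp only [choice_pay_of_not_preferGreedy hg]
      exact sum_star_pay_le hD

/-! ### Ratios and running times of the rules -/

theorem val_star (I : Market) (b : Fin I.n → ℝ) :
    I.val (star.mechanism.winners I b) = (I.toData b).starValue :=
  val_winners I b

theorem val_greedy (I : Market) (b : Fin I.n → ℝ) :
    I.val (greedy.mechanism.winners I b) = (I.toData b).total :=
  val_winners I b

theorem choice_approximates : choice.mechanism.Approximates (2 + √2) := by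
  classical
  intro I c hc
  have hD : (I.toData c).Valid := toData_valid hc
  refine opt_le fun T hT => ?_
  by_cases hg : (I.toData c).PreferGreedy
  · have hval : I.val (choice.mechanism.winners I c) = (I.toData c).total := by
      rw [← val_greedy]
      congr 1
      ext i
      rw [mem_winners, mem_winners, choice_wins_of_preferGreedy hg]
      rfl
    rw [hval]
    have h1 := hT.value_le hD
    have h2 := hg.starValue_le hD
    -- Since `√2 * (√2 / 2) = 1`, this turns the lower bound on the total into `starValue ≤ √2 *
    -- total`.
    have h3 : (I.toData c).starValue = √2 * (√2 / 2 * (I.toData c).starValue) := by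
      rw [← mul_assoc, ← mul_div_assoc, Real.mul_self_sqrt zero_le_two]
      ring
    have h4 := mul_le_mul_of_nonneg_left h2 (Real.sqrt_nonneg 2)
    linarith
  · have hval : I.val (choice.mechanism.winners I c) = (I.toData c).starValue := by
      rw [← val_star]
      congr 1
      ext i
      rw [mem_winners, mem_winners, choice_wins_of_not_preferGreedy hg]
      rfl
    rw [hval]
    exact hT.value_le_of_not_preferGreedy hD hg

theorem star_polyTime : star.mechanism.PolyTime :=
  polyTime (decides_star 0) (.ite (decides_star 0) .budget .zero)

theorem greedy_polyTime : greedy.mechanism.PolyTime :=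
  polyTime (decides_top_accepted 0)
    (.ite (decides_top_accepted 0) ((Computes.value (.var 0)).mul computes_price) .zero)

theorem choice_polyTime : choice.mechanism.PolyTime := by
  refine polyTime ?_ ?_
  · refine Decides.congr (p := fun e => (e.data.PreferGreedy ∧ e.data.Top e.data.Accepted (e.var 0))
      ∨ (¬ e.data.PreferGreedy ∧ e.data.Star (e.var 0)))
      ((decides_preferGreedy.and (decides_top_accepted 0)).or
        (decides_preferGreedy.not.and (decides_star 0))) fun e => ?_
    by_cases hg : e.data.PreferGreedy <;> simp [choice, hg]
  · exact .ite decides_preferGreedy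
      (.ite (decides_top_accepted 0) ((Computes.value (.var 0)).mul
        (.ite ((decides_pivotal 0).and (decides_star 0).not)
          (computes_price.min computes_testRate) computes_price)) .zero)
      (.ite (decides_star 0) .budget .zero)

end Rule

/-! ### The randomized mechanism -/

/-- Roll a fair three-sided die; buy the most valuable item on one side, and otherwise use the
greedy rule. -/
noncomputable def diceMechanism : RandomizedMechanism where
  Ω := Fin 3
  law := PMF.uniformOfFintype (Fin 3)
  mech := ![Rule.star.mechanism, Rule.greedy.mechanism, Rule.greedy.mechanism]

theorem diceMechanism_law (ω : Fin 3) : (diceMechanism.law ω).toReal = 1 / 3 := by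
  change ((PMF.uniformOfFintype (Fin 3)) ω).toReal = 1 / 3
  simp [PMF.uniformOfFintype_apply]

theorem diceMechanism_isUniversallyTruthfulBudgetFeasible :
    diceMechanism.IsUniversallyTruthfulBudgetFeasible := by
  intro ω
  change Fin 3 at ω
  fin_cases ω
  exacts [Rule.star_sound.isTruthfulBudgetFeasible, Rule.greedy_sound.isTruthfulBudgetFeasible,
    Rule.greedy_sound.isTruthfulBudgetFeasible]

theorem diceMechanism_expectedVal (I : Market) (b : Fin I.n → ℝ) :
    diceMechanism.expectedVal I b =
      1 / 3 * ((I.toData b).starValue + 2 * (I.toData b).total) := by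
  have h : diceMechanism.expectedVal I b = ∑ ω : Fin 3, (diceMechanism.law ω).toReal *
      I.val ((diceMechanism.mech ω).winners I b) := rfl
  rw [h, Fin.sum_univ_three, diceMechanism_law, diceMechanism_law, diceMechanism_law,
    ← Rule.val_star, ← Rule.val_greedy]
  simp only [diceMechanism, Matrix.cons_val]
  ring

/-- The probabilities 1/3 and 2/3 are proportional to the coefficients 1 and 2 of `starValue` and
`total` in `Solution.value_le`. -/
theorem diceMechanism_approximates : diceMechanism.Approximates 3 := by
  intro I c hc
  rw [diceMechanism_expectedVal]
  refine opt_le fun T hT => ?_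
  linarith [hT.value_le (toData_valid hc)]

theorem diceMechanism_polyTime : diceMechanism.PolyTime := by
  refine ⟨fun ω => ⟨1 / 3, (diceMechanism_law ω).trans (by norm_num)⟩, fun ω => ?_⟩
  change Fin 3 at ω
  fin_cases ω
  exacts [Rule.star_polyTime, Rule.greedy_polyTime, Rule.greedy_polyTime]

end HetKnapsack

theorem mainTheorem8 :
    (∃ M : HetKnapsack.Mechanism,
      M.IsTruthfulBudgetFeasible ∧ M.Approximates (2 + Real.sqrt 2) ∧ M.PolyTime) ∧
    (∃ R : HetKnapsack.RandomizedMechanism,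
      R.IsUniversallyTruthfulBudgetFeasible ∧ R.Approximates 3 ∧ R.PolyTime) :=
  ⟨⟨HetKnapsack.Rule.choice.mechanism,
      HetKnapsack.Rule.choice_sound.isTruthfulBudgetFeasible,
      HetKnapsack.Rule.choice_approximates, HetKnapsack.Rule.choice_polyTime⟩,
    ⟨HetKnapsack.diceMechanism,
      HetKnapsack.diceMechanism_isUniversallyTruthfulBudgetFeasible,
      HetKnapsack.diceMechanism_approximates, HetKnapsack.diceMechanism_polyTime⟩⟩
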